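/- Let $\tau>0$, let $\mathcal P=\mathcal P_\tau$ be a homogeneous Poisson point process of intensity $\tau$ in $\mathbb R^2$, and let $\bar{\mathcal P}=\{(x,\alpha_x)\}_{x\in\mathcal P}$, where the marks $\alpha_x$ are i.i.d. uniform on $[0,\pi)$ and independent of $\mathcal P$. A marked configuration $\bar{\mathcal X}$ with distinct locations generates a Gilbert crack tessellation $G(\bar{\mathcal X})$: at time $0$ every seed $x$ emits an upper and a lower branch, in the directions $\hat\alpha_x=(\cos\alpha_x,\sin\alpha_x)$ and $-\hat\alpha_x$, both growing at unit speed, and each branch stops at the first time when its tip meets a branch of another seed that is already present there (i.e. that reached this point no later). Let $\xi^{\pm}(\bar x,\bar{\mathcal X})\in[0,\infty]$ be the final lengths of the upper and of the lower branch emitted from $x$; if $\bar x\notin\bar{\mathcal X}$, then $\bar x$ is first added to $\bar{\mathcal X}$. A fixed location $x\in\mathbb R^2$ gets a mark $\alpha_x$ uniform on $[0,\pi)$ and independent of $\bar{\mathcal P}$, and $\bar x=(x,\alpha_x)$. Let $B(x,r)$ be the ball of radius $r$ around $x$, and write $\bar{\mathcal P}\cap B(x,r)$ for the set of marked points of $\bar{\mathcal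 P}$ with location in $B(x,r)$. The functionals $\xi^+$ and $\xi^-$ stabilize exponentially on $\bar{\mathcal P}$. That is, there are constants $C,M>0$, depending only on $\tau$, such that for $\xi\in\{\xi^+,\xi^-\}$ and every $x\in\mathbb R^2$ there is an a.s. finite random variable $R=R[\bar x,\bar{\mathcal P}]\ge 0$, a function of $\bar x$ and $\bar{\mathcal P}$, with the following properties: almost surely $$\xi(\bar x,\bar{\mathcal P}\cap B(x,R))=\xi(\bar x,(\bar{\mathcal P}\cap B(x,R))\cup\bar A)$$ for every finite $A\subset B(x,R)^c$ and every marking $\bar A$ of $A$ by angles in $[0,\pi)$, and $$\mathbf P(R>r)\le Me^{-Cr}\qquad\text{for all } r>0 .$$ Hence the whole-plane tessellation and its branch lengths are well defined and a.s. finite: (i) for every $x\in\mathbb R^2$, almost surely the growth rules on the infinite configuration $\bar{\mathcal P}\cup\{\bar x\}$ determine a unique family of branch lengths, and $\xi(\bar x,\bar{\mathcal P})=\xi(\bar x,\bar{\mathcal P}\cap B(x,R))=\lim_{\varrho\to\infty}\xi(\bar x,\bar{\mathcal P}\cap B(x,\varrho))<\infty$, where the last sequence is eventually constant; (ii) almost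 surely the growth rules on $\bar{\mathcal P}$ determine a unique family of branch lengths, for all $x\in\mathcal P$ simultaneously $\xi^{\pm}(\bar x,\bar{\mathcal P})<\infty$ and $\xi^{\pm}(\bar x,\bar{\mathcal P}\cap B(x,\varrho))=\xi^{\pm}(\bar x,\bar{\mathcal P})$ for all large $\varrho$, and the whole-plane tessellation is $G(\bar{\mathcal P})=\bigcup_{x\in\mathcal P}[x,x+\xi^+(\bar x,\bar{\mathcal P})\hat\alpha_x]\cup[x,x-\xi^-(\bar x,\bar{\mathcal P})\hat\alpha_x]$. -/

import Mathlib

noncomputable section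

namespace Gilbert

open MeasureTheory ProbabilityTheory Filter Topology
open scoped ENNReal NNReal

/-! ### Deterministic part: growth of cracks from a marked point configuration -/

/-- The Euclidean plane. -/
abbrev Plane : Type := EuclideanSpace ℝ (Fin 2)

/-- A seed together with its angular mark. -/
abbrev MarkedPoint : Type := Plane × ℝ

/-- The unit vector making the angle `α` with the first axis. -/
def dir (α : ℝ) : Plane := !₂[Real.cos α, Real.sin α]

/-- The two branches emitted by a seed. -/
inductive Side : Type
  | upper
  | lower

/-- `+1` for the upper branch, `-1` for the lower branch. -/
def Side.sign : Side → ℝ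
  | .upper => 1
  | .lower => -1

/-- Position at time `t` of the (not yet blocked) tip of the branch `σ` emitted by `p`. -/
def tip (p : MarkedPoint) (σ : Side) (t : ℝ) : Plane := p.1 + (σ.sign * t) • dir p.2

/-- The locations are distinct and every mark is an angle in `[0, π)`. -/
def IsMarkedConfiguration (X : Set MarkedPoint) : Prop :=
  Set.InjOn Prod.fst X ∧ ∀ p ∈ X, p.2 ∈ Set.Ico 0 Real.pi

/-- The marked points of `X` whose spatial locations fall into `D`. -/
def restrictTo (X : Set MarkedPoint) (D : Set Plane) : Set MarkedPoint := {p ∈ X | p.1 ∈ D}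

/-- If the branches have final lengths `ℓ`, then the branch `σ` of `p`, provided it is still growing
just before time `t`, meets at time `t` a branch of another seed of `X` that is already present
there: the meeting point was reached by the other branch at some time `s ≤ t`. -/
def IsBlockedAt (X : Set MarkedPoint) (ℓ : MarkedPoint → Side → ℝ≥0∞)
    (p : MarkedPoint) (σ : Side) (t : ℝ) : Prop :=
  ∃ q ∈ X, q ≠ p ∧ ∃ (σ' : Side) (s : ℝ),
    0 ≤ s ∧ s ≤ t ∧ ENNReal.ofReal s ≤ ℓ q σ' ∧ tip q σ' s = tip p σ t

/-- `ℓ` records the final lengths of all branches when the cracks grow at unit speed from the seeds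
of `X`, each branch stopping at the first time when it meets a branch already present (and never,
i.e. with length `∞`, if there is no such time). Off `X` the lengths are set to `0`. -/
def IsGrowth (X : Set MarkedPoint) (ℓ : MarkedPoint → Side → ℝ≥0∞) : Prop :=
  (∀ p ∈ X, ∀ σ, ℓ p σ = ⨅ (t : ℝ) (_ : IsBlockedAt X ℓ p σ t), ENNReal.ofReal t) ∧
  ∀ p ∉ X, ∀ σ, ℓ p σ = 0

open Classical in
/-- The final length of the branch `σ` of `p` in the growth process of `X`. -/
def branchLength (X : Set MarkedPoint) (p : MarkedPoint) (σ : Side) : ℝ≥0∞ :=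
  if h : ∃ ℓ, IsGrowth X ℓ then h.choose p σ else 0

/-- The branch-length functionals: `ξ .upper` is `ξ⁺` and `ξ .lower` is `ξ⁻`. A marked point that
does not belong to the configuration is added to it. -/
def ξ (σ : Side) (p : MarkedPoint) (X : Set MarkedPoint) : ℝ≥0∞ :=
  branchLength (insert p X) p σ

/-- The Gilbert tessellation of `X`: the union of all fully grown branches. -/
def tessellation (X : Set MarkedPoint) : Set Plane :=
  {z | ∃ p ∈ X, ∃ (σ : Side) (t : ℝ), 0 ≤ t ∧ ENNReal.ofReal t ≤ branchLength X p σ ∧ z = tip p σ t}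

/-! ### The growth process of a finite configuration is well defined -/

open Classical in
/-- The lengths that result when the blocking obstacles are the branches of lengths `ℓ`. -/
def growthMap (X : Set MarkedPoint) (ℓ : MarkedPoint → Side → ℝ≥0∞) :
    MarkedPoint → Side → ℝ≥0∞ := fun p σ =>
  if p ∈ X then ⨅ (t : ℝ) (_ : IsBlockedAt X ℓ p σ t), ENNReal.ofReal t else 0

theorem isGrowth_iff (X : Set MarkedPoint) (ℓ : MarkedPoint → Side → ℝ≥0∞) :
    IsGrowth X ℓ ↔ ℓ = growthMap X ℓ := by
  constructor
  · rintro ⟨h1, h2⟩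
    funext p σ
    by_cases hp : p ∈ X
    · simpa [growthMap, hp] using h1 p hp σ
    · simpa [growthMap, hp] using h2 p hp σ
  · intro h
    refine ⟨fun p hp σ => ?_, fun p hp σ => ?_⟩
    · conv_lhs => rw [h]
      simp [growthMap, hp]
    · rw [h]
      simp [growthMap, hp]

/-- Two length functions describe the same growth up to time `T`. -/
def Agree (T : ℝ) (ℓ ℓ' : MarkedPoint → Side → ℝ≥0∞) : Prop :=
  ∀ p σ s, 0 ≤ s → s ≤ T → (ENNReal.ofReal s ≤ ℓ p σ ↔ ENNReal.ofReal s ≤ ℓ' p σ)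

theorem Agree.symm {T : ℝ} {ℓ ℓ' : MarkedPoint → Side → ℝ≥0∞} (h : Agree T ℓ ℓ') :
    Agree T ℓ' ℓ := fun p σ s h0 h1 => (h p σ s h0 h1).symm

theorem Agree.trans {T : ℝ} {ℓ ℓ' ℓ'' : MarkedPoint → Side → ℝ≥0∞} (h : Agree T ℓ ℓ')
    (h' : Agree T ℓ' ℓ'') : Agree T ℓ ℓ'' :=
  fun p σ s h0 h1 => (h p σ s h0 h1).trans (h' p σ s h0 h1)

theorem Agree.mono {T T' : ℝ} {ℓ ℓ' : MarkedPoint → Side → ℝ≥0∞} (h : Agree T ℓ ℓ')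
    (hT : T' ≤ T) : Agree T' ℓ ℓ' := fun p σ s h0 h1 => h p σ s h0 (h1.trans hT)

theorem eq_of_agree {ℓ ℓ' : MarkedPoint → Side → ℝ≥0∞} (h : ∀ T, Agree T ℓ ℓ') : ℓ = ℓ' := by
  funext p σ
  refine ENNReal.eq_of_forall_nnreal_le_iff fun r => ?_
  have := h r p σ r r.2 le_rfl
  simpa using this

theorem agree_growthMap_aux {X : Set MarkedPoint} {T T' : ℝ}
    {ℓ ℓ' : MarkedPoint → Side → ℝ≥0∞} (h : Agree T ℓ ℓ')
    (hgap : ∀ p ∈ X, ∀ q ∈ X, q ≠ p → ∀ σ σ' s t, T < s → s ≤ t → t < T' →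
      tip q σ' s ≠ tip p σ t)
    (p : MarkedPoint) (σ : Side) (s : ℝ) (hs : s ≤ T')
    (hle : ENNReal.ofReal s ≤ growthMap X ℓ p σ) :
    ENNReal.ofReal s ≤ growthMap X ℓ' p σ := by
  by_cases hp : p ∈ X
  · simp only [growthMap, hp, if_true, le_iInf_iff] at hle ⊢
    rintro t ⟨q, hq, hqp, σ', s', hs0, hst, hl, ht⟩
    by_contra hcon
    have hts : t < s := by
      by_contra h'
      exact hcon (ENNReal.ofReal_le_ofReal (not_lt.1 h'))
    rcases le_or_gt s' T with h1 | h1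
    · exact hcon (hle t ⟨q, hq, hqp, σ', s', hs0, hst, (h q σ' s' hs0 h1).2 hl, ht⟩)
    · exact hgap p hp q hq hqp σ σ' s' t h1 hst (hts.trans_le hs) ht
  · simpa [growthMap, hp] using hle

theorem agree_growthMap {X : Set MarkedPoint} {T T' : ℝ}
    {ℓ ℓ' : MarkedPoint → Side → ℝ≥0∞} (h : Agree T ℓ ℓ')
    (hgap : ∀ p ∈ X, ∀ q ∈ X, q ≠ p → ∀ σ σ' s t, T < s → s ≤ t → t < T' →
      tip q σ' s ≠ tip p σ t) : Agree T' (growthMap X ℓ) (growthMap X ℓ') :=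
  fun p σ s _ hs => ⟨agree_growthMap_aux h hgap p σ s hs, agree_growthMap_aux h.symm hgap p σ s hs⟩

theorem norm_dir (α : ℝ) : ‖dir α‖ = 1 := by
  simp [dir, EuclideanSpace.norm_eq, Fin.sum_univ_two]

theorem abs_sign (σ : Side) : |σ.sign| = 1 := by cases σ <;> simp [Side.sign]

theorem tip_sub (p : MarkedPoint) (σ : Side) (t T : ℝ) :
    tip p σ t - tip p σ T = (t - T) • (σ.sign • dir p.2) := by
  simp only [tip, smul_smul, add_sub_add_left_eq_sub, ← sub_smul]
  congr 1
  ring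

theorem norm_tip_sub (p : MarkedPoint) (σ : Side) (t T : ℝ) :
    ‖tip p σ t - tip p σ T‖ = |t - T| := by
  rw [tip_sub, norm_smul, norm_smul, norm_dir, Real.norm_eq_abs, Real.norm_eq_abs, abs_sign]
  ring

/-- Near any time `T` two given branches of distinct seeds cannot meet with both arrival times
strictly before `T`, or both strictly after `T`. -/
theorem exists_gap_pair {p q : MarkedPoint} (hpq : q.1 ≠ p.1) (σ σ' : Side) (T : ℝ) :
    ∃ δ > 0, ∀ s t, |s - T| < δ → |t - T| < δ → 0 < (s - T) * (t - T) →
      tip q σ' s ≠ tip p σ t := by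
  by_cases hT : tip q σ' T = tip p σ T
  · refine ⟨1, one_pos, fun s t _ _ hst h => hpq ?_⟩
    have e : (s - T) • (σ'.sign • dir q.2) = (t - T) • (σ.sign • dir p.2) := by
      rw [← tip_sub, ← tip_sub, h, hT]
    have hn : |s - T| = |t - T| := by rw [← norm_tip_sub q σ', ← norm_tip_sub p σ, h, hT]
    have hst' : s - T = t - T := by
      rcases abs_eq_abs.1 hn with h' | h'
      · exact h'
      · rw [h'] at hst
        nlinarith [sq_nonneg (t - T)]
    have hne : t - T ≠ 0 := fun h0 => by simp [h0] at hst
    rw [hst'] at e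
    have hu : σ'.sign • dir q.2 = σ.sign • dir p.2 := smul_right_injective _ hne e
    have h1 : tip q σ' T = q.1 + T • (σ'.sign • dir q.2) := by simp [tip, smul_smul, mul_comm]
    have h2 : tip p σ T = p.1 + T • (σ.sign • dir p.2) := by simp [tip, smul_smul, mul_comm]
    rw [h1, h2, hu] at hT
    exact add_right_cancel hT
  · have hd : 0 < ‖tip q σ' T - tip p σ T‖ := norm_pos_iff.2 (sub_ne_zero.2 hT)
    refine ⟨‖tip q σ' T - tip p σ T‖ / 2, half_pos hd, fun s t hs ht _ h => ?_⟩
    have : ‖tip q σ' T - tip p σ T‖ ≤ |t - T| + |s - T| := by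
      rw [← norm_tip_sub p σ, ← norm_tip_sub q σ', h, ← norm_neg (tip p σ t - tip q σ' T)]
      calc _ = ‖(tip p σ t - tip p σ T) + -(tip p σ t - tip q σ' T)‖ := by congr 1; abel
        _ ≤ _ := norm_add_le _ _
    linarith

theorem exists_gap {X : Set MarkedPoint} (hX : X.Finite) (hinj : Set.InjOn Prod.fst X) (T : ℝ) :
    ∃ δ > 0, ∀ p ∈ X, ∀ q ∈ X, q ≠ p → ∀ σ σ' s t, |s - T| < δ → |t - T| < δ →
      0 < (s - T) * (t - T) → tip q σ' s ≠ tip p σ t := by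
  have key : ∀ᶠ δ in 𝓝[>] (0 : ℝ), ∀ p ∈ X, ∀ q ∈ X, ∀ σ ∈ ({.upper, .lower} : Set Side),
      ∀ σ' ∈ ({.upper, .lower} : Set Side), q ≠ p → ∀ s t, |s - T| < δ → |t - T| < δ →
      0 < (s - T) * (t - T) → tip q σ' s ≠ tip p σ t := by
    refine (eventually_all_finite hX).2 fun p hp => (eventually_all_finite hX).2 fun q hq =>
      (eventually_all_finite (by simp)).2 fun σ _ =>
      (eventually_all_finite (by simp)).2 fun σ' _ => ?_
    by_cases hqp : q = p
    · exact Eventually.of_forall fun _ h => absurd hqp h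
    · obtain ⟨δ, hδ, h⟩ := exists_gap_pair (p := p) (q := q)
        (fun h => hqp (hinj hq hp h)) σ σ' T
      filter_upwards [Ioo_mem_nhdsGT hδ] with ε hε _ s t hs ht
      exact h s t (hs.trans hε.2) (ht.trans hε.2)
  obtain ⟨δ, h, hδ⟩ := (key.and self_mem_nhdsWithin).exists
  exact ⟨δ, hδ, fun p hp q hq hqp σ σ' => h p hp q hq σ (by cases σ <;> simp) σ'
    (by cases σ' <;> simp) hqp⟩

theorem exists_agree_step {X : Set MarkedPoint} (hX : X.Finite) (hinj : Set.InjOn Prod.fst X)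
    (T : ℝ) : ∃ δ > 0, ∀ T₀ ℓ ℓ', T - δ < T₀ → T₀ ≤ T → Agree T₀ ℓ ℓ' →
      Agree (T + δ) (growthMap X (growthMap X ℓ)) (growthMap X (growthMap X ℓ')) := by
  obtain ⟨δ, hδ, h⟩ := exists_gap hX hinj T
  refine ⟨δ, hδ, fun T₀ ℓ ℓ' h0 h1 hag => ?_⟩
  refine agree_growthMap (T := T) (agree_growthMap hag ?_) ?_
  · intro p hp q hq hqp σ σ' s t h2 h3 h4
    refine h p hp q hq hqp σ σ' s t ?_ ?_ ?_
    · rw [abs_lt]; constructor <;> linarith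
    · rw [abs_lt]; constructor <;> linarith
    · exact mul_pos_of_neg_of_neg (by linarith) (by linarith)
  · intro p hp q hq hqp σ σ' s t h2 h3 h4
    refine h p hp q hq hqp σ σ' s t ?_ ?_ ?_
    · rw [abs_lt]; constructor <;> linarith
    · rw [abs_lt]; constructor <;> linarith
    · exact mul_pos (by linarith) (by linarith)

theorem real_induction {S : Set ℝ} (h0 : (0 : ℝ) ∈ S)
    (hdown : ∀ a ∈ S, ∀ b ≤ a, b ∈ S)
    (hstep : ∀ T, ∃ δ > 0, ∀ T₀ ∈ S, T - δ < T₀ → T₀ ≤ T → T + δ ∈ S) (T : ℝ) : T ∈ S := by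
  by_contra hT
  have hbdd : BddAbove S := ⟨T, fun a ha => le_of_not_gt fun h => hT (hdown a ha T h.le)⟩
  obtain ⟨δ, hδ, h⟩ := hstep (sSup S)
  obtain ⟨T₀, hT₀, h1⟩ := exists_lt_of_lt_csSup ⟨0, h0⟩ (sub_lt_self (sSup S) hδ)
  have := le_csSup hbdd (h T₀ hT₀ h1 (le_csSup hbdd hT₀))
  linarith

theorem agree_zero (ℓ ℓ' : MarkedPoint → Side → ℝ≥0∞) : Agree 0 ℓ ℓ' := by
  intro p σ s _ h
  simp [ENNReal.ofReal_eq_zero.2 h]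

/-- A finite configuration with distinct locations determines all its branch lengths. -/
theorem existsUnique_isGrowth {X : Set MarkedPoint} (hX : X.Finite)
    (hinj : Set.InjOn Prod.fst X) : ∃! ℓ, IsGrowth X ℓ := by
  simp only [isGrowth_iff]
  refine existsUnique_of_exists_of_unique ?_ ?_
  · let L : ℕ → MarkedPoint → Side → ℝ≥0∞ := fun n => (growthMap X)^[n] fun _ _ => 0
    have hL : ∀ n, L (n + 1) = growthMap X (L n) := fun n => Function.iterate_succ_apply' _ _ _
    have hpers : ∀ T n, Agree T (L n) (L (n + 1)) → ∀ m, Agree T (L n) (L (n + m)) := by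
      intro T n h
      have h' : ∀ m, Agree T (L (n + m)) (L (n + m + 1)) := by
        intro m
        induction m with
        | zero => exact h
        | succ m ih =>
          rw [← add_assoc, hL (n + m), hL (n + m + 1)]
          exact agree_growthMap ih fun _ _ _ _ _ _ _ s t h1 h2 h3 =>
            absurd (h1.trans_le h2) h3.le.not_gt
      intro m
      induction m with
      | zero => exact fun _ _ _ _ _ => Iff.rfl
      | succ m ih => exact ih.trans (h' m)
    have hall : ∀ T, T ∈ {T : ℝ | ∃ n, Agree T (L n) (L (n + 1))} := by
      refine real_induction ⟨0, agree_zero _ _⟩ (fun a ⟨n, h⟩ b hb => ⟨n, h.mono hb⟩) fun T => ?_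
      obtain ⟨δ, hδ, h⟩ := exists_agree_step hX hinj T
      refine ⟨δ, hδ, fun T₀ ⟨n, hn⟩ h1 h2 => ⟨n + 2, ?_⟩⟩
      have := h T₀ _ _ h1 h2 hn
      rw [← hL, ← hL, ← hL] at this
      exact this
    let ℓ : MarkedPoint → Side → ℝ≥0∞ := fun p σ =>
      ⨆ (s : ℝ) (_ : ∀ᶠ n in atTop, ENNReal.ofReal s ≤ L n p σ), ENNReal.ofReal s
    have hlim : ∀ T n, Agree T (L n) (L (n + 1)) → Agree T (L n) ℓ := by
      intro T n h p σ s h0 hs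
      have hp := hpers T n h
      constructor
      · intro hle
        refine le_iSup₂_of_le s ?_ le_rfl
        filter_upwards [eventually_ge_atTop n] with m hm
        obtain ⟨k, rfl⟩ := Nat.exists_eq_add_of_le hm
        exact (hp k p σ s h0 hs).1 hle
      · intro hle
        by_contra hcon
        refine absurd (hle.trans (iSup₂_le fun s' hs' => ?_)) hcon
        obtain ⟨m, h1, h2⟩ := (hs'.and (eventually_ge_atTop n)).exists
        obtain ⟨k, rfl⟩ := Nat.exists_eq_add_of_le h2
        rcases le_or_gt s s' with h3 | h3
        · exact absurd ((hp k p σ s h0 hs).2 ((ENNReal.ofReal_le_ofReal h3).trans h1)) hcon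
        · rcases le_or_gt 0 s' with h4 | h4
          · exact (hp k p σ s' h4 (h3.le.trans hs)).2 h1
          · simp [ENNReal.ofReal_of_nonpos h4.le]
    refine ⟨ℓ, eq_of_agree fun T => ?_⟩
    obtain ⟨n, hn⟩ := hall T
    have h1 := hlim T n hn
    have h2 : Agree T (growthMap X (L n)) (growthMap X ℓ) :=
      agree_growthMap h1 fun _ _ _ _ _ _ _ s t h1 h2 h3 => absurd (h1.trans_le h2) h3.le.not_gt
    rw [← hL] at h2
    exact h1.symm.trans (hn.trans h2)
  · intro ℓ ℓ' h h'
    refine eq_of_agree fun T => ?_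
    refine real_induction (S := {T | Agree T ℓ ℓ'}) (agree_zero _ _)
      (fun a ha b hb => Agree.mono ha hb) (fun T => ?_) T
    obtain ⟨δ, hδ, hs⟩ := exists_agree_step hX hinj T
    refine ⟨δ, hδ, fun T₀ hT₀ h1 h2 => ?_⟩
    have := hs T₀ _ _ h1 h2 hT₀
    rwa [← h, ← h, ← h', ← h'] at this

theorem isGrowth_branchLength {X : Set MarkedPoint} (h : ∃ ℓ, IsGrowth X ℓ) :
    IsGrowth X (branchLength X) := by
  have : branchLength X = h.choose := by
    funext p σ
    simp [branchLength, h]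
  rw [this]
  exact h.choose_spec

/-! ### Probabilistic part -/

variable {Ω : Type*} [MeasurableSpace Ω]

/-- The uniform distribution on `[0, π)`. -/
def markLaw : Measure ℝ := (volume : Measure ℝ)[|Set.Ico 0 Real.pi]

/-- `Q` is a homogeneous Poisson point process of intensity `τ` in the plane. -/
structure IsPoissonProcess (P : Measure Ω) (τ : ℝ≥0) (Q : Ω → Set Plane) : Prop where
  /-- The number of points in a bounded Borel set is Poisson distributed. -/
  count_law : ∀ B : Set Plane, MeasurableSet B → Bornology.IsBounded B →
    HasLaw (fun ω => (Q ω ∩ B).encard)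
      ((poissonMeasure (τ * (volume B).toNNReal)).map (Nat.cast : ℕ → ℕ∞)) P
  /-- The numbers of points in disjoint bounded Borel sets are independent. -/
  count_indep : ∀ (n : ℕ) (B : Fin n → Set Plane), (∀ i, MeasurableSet (B i)) →
    (∀ i, Bornology.IsBounded (B i)) → Pairwise (fun i j => Disjoint (B i) (B j)) →
    iIndepFun (fun i ω => (Q ω ∩ B i).encard) P

/-- The points `x 0, x 1, …` enumerate without repetition a homogeneous Poisson point process of
intensity `τ`, and `α 0, α 1, …` are i.i.d. marks, uniform on `[0, π)` and independent of the
points. -/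
structure IsMarkedPoissonProcess (P : Measure Ω) (τ : ℝ≥0) (x : ℕ → Ω → Plane) (α : ℕ → Ω → ℝ) :
    Prop where
  measurable_point : ∀ n, Measurable (x n)
  measurable_mark : ∀ n, Measurable (α n)
  ae_injective : ∀ᵐ ω ∂P, Function.Injective fun n => x n ω
  poisson : IsPoissonProcess P τ fun ω => Set.range fun n => x n ω
  mark_law : ∀ n, HasLaw (α n) markLaw P
  mark_indep : iIndepFun α P
  indep : IndepFun (fun ω n => x n ω) (fun ω n => α n ω) P

/-- The additional mark `a` is uniform on `[0, π)` and independent of the marked process. -/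
structure IsExtraMark (P : Measure Ω) (x : ℕ → Ω → Plane) (α : ℕ → Ω → ℝ) (a : Ω → ℝ) :
    Prop where
  measurable : Measurable a
  law : HasLaw a markLaw P
  indep : IndepFun a (fun ω => ((fun n => x n ω), (fun n => α n ω))) P

/-- The marked point process as a random set of marked points. -/
def markedProcess (x : ℕ → Ω → Plane) (α : ℕ → Ω → ℝ) (ω : Ω) : Set MarkedPoint :=
  Set.range fun n => (x n ω, α n ω)

/-- `R` is a stabilization radius at `z` for the functional `f` on the random input `X`, where `a`
is the mark attached to `z`: almost surely, `f` evaluated on the input in the ball of radius `R`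
around `z` is not affected by any finite marked configuration `A` added outside this ball. -/
def IsStabilizationRadius (f : MarkedPoint → Set MarkedPoint → ℝ≥0∞) (P : Measure Ω)
    (X : Ω → Set MarkedPoint) (a : Ω → ℝ) (z : Plane) (R : Ω → ℝ≥0) : Prop :=
  AEMeasurable R P ∧
  ∀ᵐ ω ∂P, ∀ A : Set MarkedPoint, A.Finite → IsMarkedConfiguration A →
    (∀ p ∈ A, p.1 ∉ Metric.closedBall z (R ω)) →
    f (z, a ω) (restrictTo (X ω) (Metric.closedBall z (R ω))) =
      f (z, a ω) (restrictTo (X ω) (Metric.closedBall z (R ω)) ∪ A)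

end Gilbert

end

noncomputable section

namespace Gilbert

open MeasureTheory ProbabilityTheory Filter Topology
open scoped ENNReal NNReal

/-! ### Finite propagation speed -/

/-! Two facts carry the theorem. The first is finite propagation. Tips move at unit speed and can be
blocked only by a branch that arrived no later, so survival of a branch until time `s` is decided
inside the backward light cone of its tip, hence by the seeds within `2 * s` of its origin
(`agreeInCone`, `le_iff_of_locally_eq`). Patching finite windows then yields the growth of any
locally finite configuration, and a bound `ξ < s` makes `2 * s` a stabilization radius: seeds
farther away cannot change the length.

The second is blocking. A seed that is alone in a disc of radius 2, close to its centre and with a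
transversal mark, stops every branch arriving near the centre, whatever happens outside the disc
(`IsGrowth.le_of_hasObstacle`). Put `k` disjoint discs along a ray. Each holds such an obstacle with
probability at least `p = obstacleProb τ > 0`, and all of them fail with probability at most `(1 -
p) ^ k` (`measure_forall_not_hasObstacle_le`). Finitely many rays, their number linear in `k`,
control all directions; the union bound costs a linear factor that the exponential absorbs. If `K`
is the least `k` for which every ray has an obstacle, then `ξ ≤ 5 * K + 1`, so `10 * K + 4` is a
stabilization radius with exponential tail.

The blocking argument tolerates a displacement of the origin by `1 / 16`. Hence a countable dense
set of origins treats all seeds of the process at once, outside a single null set. -/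

theorem IsBlockedAt.nonneg {X : Set MarkedPoint} {ℓ : MarkedPoint → Side → ℝ≥0∞} {p : MarkedPoint}
    {σ : Side} {t : ℝ} (h : IsBlockedAt X ℓ p σ t) : 0 ≤ t := by
  obtain ⟨q, _, _, _, s, h0, h1, _⟩ := h
  exact h0.trans h1

theorem IsGrowth.le_iff {X : Set MarkedPoint} {ℓ : MarkedPoint → Side → ℝ≥0∞} (h : IsGrowth X ℓ)
    {p : MarkedPoint} (hp : p ∈ X) (σ : Side) (s : ℝ) :
    ENNReal.ofReal s ≤ ℓ p σ ↔ ∀ t, IsBlockedAt X ℓ p σ t → s ≤ t := by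
  rw [h.1 p hp σ]
  simp only [le_iInf_iff]
  exact forall₂_congr fun t ht => ENNReal.ofReal_le_ofReal_iff ht.nonneg

theorem IsGrowth.le_of_isBlockedAt {X : Set MarkedPoint} {ℓ : MarkedPoint → Side → ℝ≥0∞}
    (h : IsGrowth X ℓ) {p : MarkedPoint} (hp : p ∈ X) {σ : Side} {t : ℝ}
    (ht : IsBlockedAt X ℓ p σ t) : ℓ p σ ≤ ENNReal.ofReal t := by
  rw [h.1 p hp σ]
  exact iInf₂_le t ht

theorem dist_tip (p : MarkedPoint) (σ : Side) (s t : ℝ) : dist (tip p σ s) (tip p σ t) = |s - t| := by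
  rw [dist_eq_norm, norm_tip_sub]

theorem tip_zero (p : MarkedPoint) (σ : Side) : tip p σ 0 = p.1 := by simp [tip]

theorem dist_tip_self (p : MarkedPoint) (σ : Side) (t : ℝ) : dist (tip p σ t) p.1 = |t| := by
  rw [← tip_zero p σ, dist_tip, sub_zero]

/-- Two length functions describe the same growth up to time `T₀` inside the backward light cone
with apex `(y, T)`. -/
def AgreeInCone (y : Plane) (T : ℝ) (X X' : Set MarkedPoint) (T₀ : ℝ)
    (ℓ ℓ' : MarkedPoint → Side → ℝ≥0∞) : Prop :=
  ∀ p ∈ X, p ∈ X' → ∀ σ s, 0 ≤ s → s ≤ T₀ → dist (tip p σ s) y + s ≤ T →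
    (ENNReal.ofReal s ≤ ℓ p σ ↔ ENNReal.ofReal s ≤ ℓ' p σ)

theorem AgreeInCone.symm {y : Plane} {T T₀ : ℝ} {X X' : Set MarkedPoint}
    {ℓ ℓ' : MarkedPoint → Side → ℝ≥0∞} (h : AgreeInCone y T X X' T₀ ℓ ℓ') :
    AgreeInCone y T X' X T₀ ℓ' ℓ :=
  fun p hp hp' σ s h0 h1 h2 => (h p hp' hp σ s h0 h1 h2).symm

/-- A blocker that arrived by time `T₀` is common to both growths by `hag`; one that arrived later
is excluded by `hgap`. The lemma gives one implication, and symmetry gives the other. -/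
theorem agreeInCone_step_aux {y : Plane} {T : ℝ} {X X' : Set MarkedPoint}
    {ℓ ℓ' : MarkedPoint → Side → ℝ≥0∞} (hℓ : IsGrowth X ℓ) (hℓ' : IsGrowth X' ℓ')
    (hX : ∀ q : MarkedPoint, q.1 ∈ Metric.closedBall y T → (q ∈ X ↔ q ∈ X')) {T₀ T₁ : ℝ}
    (hag : AgreeInCone y T X X' T₀ ℓ ℓ')
    (hgap : ∀ p ∈ restrictTo X (Metric.closedBall y T),
      ∀ q ∈ restrictTo X (Metric.closedBall y T), q ≠ p → ∀ σ σ' s t, T₀ < s → s ≤ t → t < T₁ →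
      tip q σ' s ≠ tip p σ t)
    {p : MarkedPoint} (hp : p ∈ X) (hp' : p ∈ X') (σ : Side) {s : ℝ} (hs : s ≤ T₁)
    (hcone : dist (tip p σ s) y + s ≤ T) (hle : ENNReal.ofReal s ≤ ℓ p σ) :
    ENNReal.ofReal s ≤ ℓ' p σ := by
  rw [hℓ.le_iff hp] at hle
  rw [hℓ'.le_iff hp']
  rintro t ⟨q, hq', hqp, σ', s', h0, hst, hl, ht⟩
  by_contra! hcon
  -- By unit speed the tip is already in the cone at time `t < s`. The blocker reached the same
  -- place at `s' ≤ t`, so it is in the cone too, and both seeds lie in the base disc.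
  have ht1 : dist (tip p σ t) y + t ≤ T := by
    have := dist_triangle (tip p σ t) (tip p σ s) y
    rw [dist_tip, abs_of_neg (by linarith)] at this
    linarith
  have hs1 : dist (tip q σ' s') y + s' ≤ T := by rw [ht]; linarith
  have hqy : q.1 ∈ Metric.closedBall y T := by
    have := dist_triangle_left q.1 y (tip q σ' s')
    rw [dist_tip_self, abs_of_nonneg h0] at this
    simp only [Metric.mem_closedBall]; linarith
  have hpy : p.1 ∈ Metric.closedBall y T := by
    have := dist_triangle_left p.1 y (tip p σ t)
    rw [dist_tip_self, abs_of_nonneg (h0.trans hst)] at this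
    simp only [Metric.mem_closedBall]; linarith
  have hq := (hX q hqy).2 hq'
  rcases le_or_gt s' T₀ with h1 | h1
  · exact hcon.not_ge
      (hle t ⟨q, hq, hqp, σ', s', h0, hst, (hag q hq hq' σ' s' h0 h1 hs1).2 hl, ht⟩)
  · exact hgap p ⟨hp, hpy⟩ q ⟨hq, hqy⟩ hqp σ σ' s' t h1 hst (hcon.trans_le hs) ht

/-- Continuous induction on `T₀`. Around any time `T₂`, `exists_gap` forbids meetings whose two
arrival times are both just before or both just after `T₂`, so agreement extends first to `T₂` and
then to `T₂ + δ`. Only seeds in the base disc enter, so finiteness is needed only there. -/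
theorem agreeInCone {y : Plane} {T : ℝ} {X X' : Set MarkedPoint}
    {ℓ ℓ' : MarkedPoint → Side → ℝ≥0∞} (hℓ : IsGrowth X ℓ) (hℓ' : IsGrowth X' ℓ')
    (hX : ∀ q : MarkedPoint, q.1 ∈ Metric.closedBall y T → (q ∈ X ↔ q ∈ X'))
    (hfin : (restrictTo X (Metric.closedBall y T)).Finite) (hinj : Set.InjOn Prod.fst X) (T₀ : ℝ) :
    AgreeInCone y T X X' T₀ ℓ ℓ' := by
  have hY : restrictTo X' (Metric.closedBall y T) = restrictTo X (Metric.closedBall y T) := by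
    ext q
    simp only [restrictTo, Set.mem_ofPred_eq]
    exact and_congr_left fun h => (hX q h).symm
  have hstep : ∀ {T₀ T₁}, AgreeInCone y T X X' T₀ ℓ ℓ' →
      (∀ p ∈ restrictTo X (Metric.closedBall y T),
      ∀ q ∈ restrictTo X (Metric.closedBall y T), q ≠ p → ∀ σ σ' s t, T₀ < s → s ≤ t → t < T₁ →
      tip q σ' s ≠ tip p σ t) → AgreeInCone y T X X' T₁ ℓ ℓ' := by
    intro T₀ T₁ hag hgap p hp hp' σ s _ h1 h2
    exact ⟨agreeInCone_step_aux hℓ hℓ' hX hag hgap hp hp' σ h1 h2,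
      agreeInCone_step_aux hℓ' hℓ (fun q hq => (hX q hq).symm) hag.symm (by rwa [hY]) hp' hp σ h1 h2⟩
  refine real_induction (S := {T₀ | AgreeInCone y T X X' T₀ ℓ ℓ'}) ?_
    (fun a ha b hb p hp hp' σ s h0 h1 => ha p hp hp' σ s h0 (h1.trans hb)) (fun T₂ => ?_) T₀
  · intro p _ _ σ s _ h1 _
    simp [ENNReal.ofReal_of_nonpos h1]
  · obtain ⟨δ, hδ, h⟩ := exists_gap hfin (hinj.mono fun _ h => h.1) T₂
    refine ⟨δ, hδ, fun T₀ hT₀ h1 h2 => hstep (T₀ := T₂) (hstep hT₀ ?_) ?_⟩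
    · intro p hp q hq hqp σ σ' s t h3 h4 h5
      refine h p hp q hq hqp σ σ' s t ?_ ?_ (mul_pos_of_neg_of_neg (by linarith) (by linarith)) <;>
      · rw [abs_lt]; constructor <;> linarith
    · intro p hp q hq hqp σ σ' s t h3 h4 h5
      refine h p hp q hq hqp σ σ' s t ?_ ?_ (mul_pos (by linarith) (by linarith)) <;>
      · rw [abs_lt]; constructor <;> linarith

/-! ### Locally finite configurations -/

/-- Distinct locations, finitely many of them in every disc. -/
structure IsLocallyFinite (X : Set MarkedPoint) : Prop where
  injOn : Set.InjOn Prod.fst X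
  finite : ∀ (y : Plane) (r : ℝ), (restrictTo X (Metric.closedBall y r)).Finite

theorem IsLocallyFinite.mono {X Y : Set MarkedPoint} (hX : IsLocallyFinite X) (h : Y ⊆ X) :
    IsLocallyFinite Y :=
  ⟨hX.injOn.mono h, fun y r => (hX.finite y r).subset fun _ hp => ⟨h hp.1, hp.2⟩⟩

theorem isLocallyFinite_of_finite {X : Set MarkedPoint} (hX : X.Finite)
    (hinj : Set.InjOn Prod.fst X) : IsLocallyFinite X :=
  ⟨hinj, fun _ _ => hX.subset fun _ h => h.1⟩

theorem IsLocallyFinite.insert {X : Set MarkedPoint} (hX : IsLocallyFinite X) {p : MarkedPoint}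
    (hp : ∀ q ∈ X, q.1 ≠ p.1) : IsLocallyFinite (insert p X) := by
  refine ⟨?_, fun y r => ((hX.finite y r).insert p).subset ?_⟩
  · rintro q (rfl | hq) q' (rfl | hq') h
    · rfl
    · exact absurd h.symm (hp q' hq')
    · exact absurd h (hp q hq)
    · exact hX.injOn hq hq' h
  · rintro q ⟨rfl | hq, h⟩
    · exact Set.mem_insert _ _
    · exact Set.mem_insert_of_mem _ ⟨hq, h⟩

/-- Whether a branch survives until time `s` depends on the seeds within distance `2 s` only. -/
theorem le_iff_of_locally_eq {X X' : Set MarkedPoint} {ℓ ℓ' : MarkedPoint → Side → ℝ≥0∞}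
    (hℓ : IsGrowth X ℓ) (hℓ' : IsGrowth X' ℓ') (hlf : IsLocallyFinite X) {p : MarkedPoint}
    (hp : p ∈ X) (hp' : p ∈ X') (σ : Side) {s : ℝ} (hs : 0 ≤ s)
    (hX : ∀ q : MarkedPoint, dist q.1 p.1 ≤ 2 * s → (q ∈ X ↔ q ∈ X')) :
    ENNReal.ofReal s ≤ ℓ p σ ↔ ENNReal.ofReal s ≤ ℓ' p σ := by
  -- The apex is the tip at time `s`: its base disc has radius `s` and centre at distance `s` from
  -- the seed.
  refine agreeInCone (y := tip p σ s) (T := s) hℓ hℓ' (fun q hq => hX q ?_) (hlf.finite _ _)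
    hlf.injOn s p hp hp' σ s hs le_rfl (by simp)
  have := dist_triangle q.1 (tip p σ s) p.1
  rw [dist_tip_self, abs_of_nonneg hs] at this
  have := Metric.mem_closedBall.1 hq
  linarith

theorem ennreal_eq_of_forall_ofReal_le_iff {a b : ℝ≥0∞}
    (h : ∀ s : ℝ, 0 ≤ s → (ENNReal.ofReal s ≤ a ↔ ENNReal.ofReal s ≤ b)) : a = b :=
  ENNReal.eq_of_forall_nnreal_le_iff fun r => by simpa using h r r.2

/-- The strict bound matters: the test at `s` fails for both lengths, so the tests up to `s`
determine them completely. -/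
theorem eq_of_locally_eq {X X' : Set MarkedPoint} {ℓ ℓ' : MarkedPoint → Side → ℝ≥0∞}
    (hℓ : IsGrowth X ℓ) (hℓ' : IsGrowth X' ℓ') (hlf : IsLocallyFinite X) {p : MarkedPoint}
    (hp : p ∈ X) (hp' : p ∈ X') (σ : Side) {s : ℝ} (hs : ℓ p σ < ENNReal.ofReal s)
    (hX : ∀ q : MarkedPoint, dist q.1 p.1 ≤ 2 * s → (q ∈ X ↔ q ∈ X')) : ℓ p σ = ℓ' p σ := by
  have hs0 : 0 ≤ s := by
    by_contra! h
    simp [ENNReal.ofReal_of_nonpos h.le] at hs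
  have key : ∀ r, 0 ≤ r → r ≤ s → (ENNReal.ofReal r ≤ ℓ p σ ↔ ENNReal.ofReal r ≤ ℓ' p σ) :=
    fun r h0 h1 => le_iff_of_locally_eq hℓ hℓ' hlf hp hp' σ h0 fun q hq => hX q (by linarith)
  have hs' : ℓ' p σ < ENNReal.ofReal s := by
    rw [← not_le] at hs ⊢
    rwa [← key s hs0 le_rfl]
  refine ennreal_eq_of_forall_ofReal_le_iff fun r hr => ?_
  rcases le_or_gt r s with h | h
  · exact key r hr h
  · have := ENNReal.ofReal_le_ofReal h.le
    exact iff_of_false (hs.trans_le this).not_ge (hs'.trans_le this).not_ge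

/-- The growth process of a locally finite configuration is well defined. -/
theorem existsUnique_isGrowth_of_isLocallyFinite {X : Set MarkedPoint} (hX : IsLocallyFinite X) :
    ∃! ℓ, IsGrowth X ℓ := by
  refine existsUnique_of_exists_of_unique ?_ ?_
  · let Y : ℝ → Set MarkedPoint := fun N => restrictTo X (Metric.closedBall 0 N)
    have hY : ∀ N, IsLocallyFinite (Y N) := fun N => hX.mono fun _ h => h.1
    choose L hL using fun N => (existsUnique_isGrowth (hX.finite 0 N) (hY N).injOn).exists
    have memY : ∀ {p N}, p ∈ X → ‖p.1‖ ≤ N → p ∈ Y N := fun hp h => ⟨hp, by simpa using h⟩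
    have hLL : ∀ p ∈ X, ∀ σ s N M, 0 ≤ s → ‖p.1‖ + 2 * s ≤ N → N ≤ M →
        (ENNReal.ofReal s ≤ L N p σ ↔ ENNReal.ofReal s ≤ L M p σ) := by
      intro p hp σ s N M hs hN hM
      refine le_iff_of_locally_eq (hL N) (hL M) (hY N) (memY hp (by linarith))
        (memY hp (by linarith)) σ hs fun q hq => ?_
      have hq' : ‖q.1‖ ≤ N := by
        have := norm_le_norm_add_norm_sub p.1 q.1
        rw [← dist_eq_norm, dist_comm] at this
        linarith
      exact ⟨fun h => memY h.1 (hq'.trans hM), fun h => memY h.1 hq'⟩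
    -- Survival until `s` is read off in a window containing every seed within `2 * s` of `p`. The
    -- conjunct `p ∈ X` empties the supremum off `X`, giving the default `0`.
    let ℓ : MarkedPoint → Side → ℝ≥0∞ := fun p σ =>
      ⨆ (s : ℝ) (_ : p ∈ X ∧ 0 ≤ s ∧ ENNReal.ofReal s ≤ L (‖p.1‖ + 2 * s) p σ), ENNReal.ofReal s
    have hℓ : ∀ p ∈ X, ∀ σ s N, 0 ≤ s → ‖p.1‖ + 2 * s ≤ N →
        (ENNReal.ofReal s ≤ ℓ p σ ↔ ENNReal.ofReal s ≤ L N p σ) := by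
      intro p hp σ s N hs hN
      rw [← hLL p hp σ s _ N hs le_rfl hN]
      refine ⟨fun h => ?_, fun h => le_iSup₂_of_le s ⟨hp, hs, h⟩ le_rfl⟩
      by_contra hcon
      refine absurd (h.trans (iSup₂_le fun r hr => ?_)) hcon
      obtain ⟨_, hr0, hr⟩ := hr
      rcases le_total r s with h3 | h3
      · exact (hLL p hp σ r _ _ hr0 le_rfl (by linarith)).1 hr
      · exact absurd ((hLL p hp σ s _ _ hs le_rfl (by linarith)).2
          ((ENNReal.ofReal_le_ofReal h3).trans hr)) hcon
    refine ⟨ℓ, fun p hp σ => ennreal_eq_of_forall_ofReal_le_iff fun s hs => ?_, fun p hp σ => ?_⟩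
    -- A blocker `q` of `p` at time `t < s`, arriving at `s' ≤ t`, has `‖q.1‖ + 2 * s' ≤ ‖p.1‖ + t +
    -- 3 * s' ≤ ‖p.1‖ + 4 * s`. One window thus computes all lengths involved.
    · rw [hℓ p hp σ s (‖p.1‖ + 4 * s) hs (by linarith), (hL _).le_iff (memY hp (by linarith))]
      simp only [le_iInf_iff]
      have main : ∀ t < s, IsBlockedAt (Y (‖p.1‖ + 4 * s)) (L (‖p.1‖ + 4 * s)) p σ t ↔
          IsBlockedAt X ℓ p σ t := by
        intro t ht
        have hn : ∀ {q : MarkedPoint} {σ' s'}, 0 ≤ s' → s' ≤ t → tip q σ' s' = tip p σ t →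
            ‖q.1‖ + 2 * s' ≤ ‖p.1‖ + 4 * s := by
          intro q σ' s' h0 h1 h2
          have h3 := dist_tip_self q σ' s'
          have h4 := dist_tip_self p σ t
          rw [abs_of_nonneg h0] at h3
          rw [abs_of_nonneg (h0.trans h1)] at h4
          have h5 := dist_triangle_left q.1 p.1 (tip p σ t)
          have h6 := norm_le_norm_add_norm_sub p.1 q.1
          rw [← dist_eq_norm, dist_comm] at h6
          rw [h2] at h3
          linarith
        constructor
        · rintro ⟨q, hq, hqp, σ', s', h0, h1, h2, h3⟩
          exact ⟨q, hq.1, hqp, σ', s', h0, h1, (hℓ q hq.1 σ' s' _ h0 (hn h0 h1 h3)).2 h2, h3⟩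
        · rintro ⟨q, hq, hqp, σ', s', h0, h1, h2, h3⟩
          have := hn h0 h1 h3
          exact ⟨q, memY hq (by linarith), hqp, σ', s', h0, h1, (hℓ q hq σ' s' _ h0 this).1 h2, h3⟩
      constructor
      · intro h t ht
        refine ENNReal.ofReal_le_ofReal ?_
        by_contra! hcon
        exact hcon.not_ge (h t ((main t hcon).2 ht))
      · intro h t ht
        by_contra! hcon
        exact hcon.not_ge ((ENNReal.ofReal_le_ofReal_iff ht.nonneg).1 (h t ((main t hcon).1 ht)))
    · simp [ℓ, hp]
  · intro ℓ ℓ' h h'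
    funext p σ
    by_cases hp : p ∈ X
    · exact ennreal_eq_of_forall_ofReal_le_iff fun s hs =>
        le_iff_of_locally_eq h h' hX hp hp σ hs fun _ _ => Iff.rfl
    · rw [h.2 p hp, h'.2 p hp]

theorem IsLocallyFinite.isGrowth {X : Set MarkedPoint} (hX : IsLocallyFinite X) :
    IsGrowth X (branchLength X) :=
  isGrowth_branchLength (existsUnique_isGrowth_of_isLocallyFinite hX).exists

/-- A seed without other seeds within distance `2 s` grows undisturbed until time `s`. -/
theorem IsGrowth.le_of_isolated {X : Set MarkedPoint} {ℓ : MarkedPoint → Side → ℝ≥0∞}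
    (hℓ : IsGrowth X ℓ) {q : MarkedPoint} (hq : q ∈ X) (σ : Side) {s : ℝ}
    (h : ∀ p ∈ X, dist p.1 q.1 < 2 * s → p = q) : ENNReal.ofReal s ≤ ℓ q σ := by
  rw [hℓ.le_iff hq]
  rintro t ⟨p, hp, hpq, σ', r, h0, h1, _, h3⟩
  by_contra! hcon
  refine hpq (h p hp ?_)
  have h4 := dist_triangle_left p.1 q.1 (tip p σ' r)
  rw [dist_tip_self, h3, dist_tip_self, abs_of_nonneg h0, abs_of_nonneg (h0.trans h1)] at h4
  linarith

/-! ### Isolated transversal seeds block a branch -/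

theorem norm_dir_sub_dir_le (φ θ : ℝ) : ‖dir φ - dir θ‖ ≤ |φ - θ| := by
  rw [EuclideanSpace.norm_eq, ← Real.sqrt_sq_eq_abs]
  refine Real.sqrt_le_sqrt ?_
  have h := Real.one_sub_sq_div_two_le_cos (x := φ - θ)
  rw [Real.cos_sub] at h
  simp only [dir, Fin.sum_univ_two, PiLp.sub_apply, Real.norm_eq_abs, sq_abs, Matrix.cons_val_zero,
    Matrix.cons_val_one]
  nlinarith [Real.sin_sq_add_cos_sq φ, Real.sin_sq_add_cos_sq θ]

theorem exists_angle (p : MarkedPoint) (hp : p.2 ∈ Set.Ico 0 Real.pi) (σ : Side) :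
    ∃ φ, 0 ≤ φ ∧ φ < 2 * Real.pi ∧ ∀ t, tip p σ t = p.1 + t • dir φ := by
  obtain ⟨h0, h1⟩ := hp
  cases σ
  · exact ⟨p.2, h0, by linarith, fun t => by simp [tip, Side.sign]⟩
  · refine ⟨p.2 + Real.pi, by linarith [Real.pi_pos], by linarith, fun t => ?_⟩
    have : dir (p.2 + Real.pi) = -dir p.2 := by
      ext i
      fin_cases i <;> simp [dir]
    simp [tip, Side.sign, this]

theorem exists_tip_eq (q : MarkedPoint) (b : ℝ) : ∃ σ, tip q σ |b| = q.1 + b • dir q.2 := by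
  rcases le_total 0 b with h | h
  · exact ⟨.upper, by simp [tip, Side.sign, abs_of_nonneg h]⟩
  · exact ⟨.lower, by simp [tip, Side.sign, abs_of_nonpos h]⟩

theorem abs_mul_sin_sub_mul_cos_le (w : Plane) (β : ℝ) :
    |w 0 * Real.sin β - w 1 * Real.cos β| ≤ ‖w‖ := by
  rw [EuclideanSpace.norm_eq]
  refine Real.abs_le_sqrt ?_
  simp only [Fin.sum_univ_two, Real.norm_eq_abs, sq_abs]
  nlinarith [Real.sin_sq_add_cos_sq β, sq_nonneg (w 0 * Real.cos β + w 1 * Real.sin β)]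

/-- Solving for the intersection of two transversal lines. -/
theorem exists_smul_dir_sub_smul_dir {φ β : ℝ} (h : 1 / 2 ≤ |Real.sin (β - φ)|) (w : Plane) :
    ∃ a b : ℝ, a • dir φ - b • dir β = w ∧ |a| ≤ 2 * ‖w‖ ∧ |b| ≤ 2 * ‖w‖ := by
  have hD : Real.sin (β - φ) ≠ 0 := by
    intro h0
    rw [h0] at h
    norm_num at h
  have hdiv : ∀ γ, |(w 0 * Real.sin γ - w 1 * Real.cos γ) / Real.sin (β - φ)| ≤ 2 * ‖w‖ := by
    intro γ
    rw [abs_div, div_le_iff₀ (by linarith)]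
    nlinarith [abs_mul_sin_sub_mul_cos_le w γ, norm_nonneg w]
  -- The witnesses are the Cramer quotients, supplied by the two bounds; the determinant `sin (β -
  -- φ)`, at least `1 / 2` in modulus, explains the factor 2.
  refine ⟨_, _, ?_, hdiv β, hdiv φ⟩
  have hs := Real.sin_sub β φ
  generalize Real.sin (β - φ) = D at hs hD
  ext i
  fin_cases i
  · simp only [dir, Fin.zero_eta, PiLp.sub_apply, PiLp.smul_apply, Matrix.cons_val_zero,
      smul_eq_mul]
    field_simp
    rw [hs]
    ring
  · simp only [dir, Fin.mk_one, PiLp.sub_apply, PiLp.smul_apply, Matrix.cons_val_one,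
      Matrix.cons_val_zero, smul_eq_mul]
    field_simp
    rw [hs]
    ring

/-- Inside the disc of radius `2` around `y` there is precisely one seed of `X`; it lies close to
`y`, and its crack is transversal to the direction `θ`. -/
def HasObstacle (y : Plane) (θ : ℝ) (X : Set MarkedPoint) : Prop :=
  ∃ q ∈ X, q.1 ∈ Metric.ball y (1 / 4) ∧ 1 / 2 + 1 / 64 ≤ |Real.sin (q.2 - θ)| ∧
    ∀ q' ∈ X, q'.1 ∈ Metric.ball y 2 → q' = q

theorem HasObstacle.insert {y : Plane} {θ : ℝ} {X : Set MarkedPoint} (h : HasObstacle y θ X)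
    {p : MarkedPoint} (hp : p.1 ∉ Metric.ball y 2) : HasObstacle y θ (insert p X) := by
  obtain ⟨q, hq, h1, h2, h3⟩ := h
  refine ⟨q, Set.mem_insert_of_mem _ hq, h1, h2, ?_⟩
  rintro q' (rfl | hq') h4
  · exact absurd h4 hp
  · exact h3 q' hq' h4

/-- The point `p.1 + r • dir φ` is within `1/16 + 5/64` of the disc centre, hence within `25/64` of
the obstacle `q`. Replacing `θ` by `φ` costs `1/64` of transversality and leaves `1/2`, so the two
lines cross within `25/32` of both that point and `q`. As `1/4 + 2 * (25/32) < 2`, isolation keeps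
the crack of `q` undisturbed up to the crossing, which it reaches before time 1, whereas the branch
of `p` needs at least `r - 25/32`. -/
theorem IsGrowth.le_of_hasObstacle {X : Set MarkedPoint} {ℓ : MarkedPoint → Side → ℝ≥0∞}
    (hℓ : IsGrowth X ℓ) {p : MarkedPoint} (hp : p ∈ X) {σ : Side} {φ θ r : ℝ} {u : Plane}
    (hφ : ∀ t, tip p σ t = p.1 + t • dir φ) (hr : 5 ≤ r) (hpu : dist p.1 u ≤ 1 / 16)
    (hθ : |φ - θ| ≤ 1 / 64) (hrθ : r * |φ - θ| ≤ 5 / 64)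
    (h : HasObstacle (u + r • dir θ) θ X) : ℓ p σ ≤ ENNReal.ofReal (r + 1) := by
  obtain ⟨q, hq, hqy, hsin, huniq⟩ := h
  set y := u + r • dir θ with hy
  have hsin' : 1 / 2 ≤ |Real.sin (q.2 - φ)| := by
    have h1 : |Real.sin (q.2 - θ) - Real.sin (q.2 - φ)| ≤ |φ - θ| := by
      have := Real.abs_sin_sub_sin_le (q.2 - θ) (q.2 - φ)
      rwa [show q.2 - θ - (q.2 - φ) = φ - θ by ring] at this
    have h2 := abs_sub_abs_le_abs_sub (Real.sin (q.2 - θ)) (Real.sin (q.2 - φ))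
    linarith
  have hyp : ‖y - (p.1 + r • dir φ)‖ ≤ 1 / 16 + 5 / 64 := by
    have e : y - (p.1 + r • dir φ) = (u - p.1) + r • (dir θ - dir φ) := by
      rw [hy, smul_sub]; abel
    have h1 : ‖u - p.1‖ ≤ 1 / 16 := by rwa [← dist_eq_norm, dist_comm]
    have h2 : ‖r • (dir θ - dir φ)‖ ≤ 5 / 64 := by
      rw [norm_smul, Real.norm_of_nonneg (by linarith), norm_sub_rev]
      exact (mul_le_mul_of_nonneg_left (norm_dir_sub_dir_le φ θ) (by linarith)).trans hrθ
    rw [e]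
    exact (norm_add_le _ _).trans (add_le_add h1 h2)
  have hw : ‖q.1 - (p.1 + r • dir φ)‖ ≤ 25 / 64 := by
    have h1 : ‖q.1 - y‖ < 1 / 4 := by rw [← dist_eq_norm]; exact hqy
    have := norm_add_le (q.1 - y) (y - (p.1 + r • dir φ))
    rw [sub_add_sub_cancel] at this
    linarith
  obtain ⟨a, b, hab, ha, hb⟩ := exists_smul_dir_sub_smul_dir hsin' (q.1 - (p.1 + r • dir φ))
  obtain ⟨σ', hσ'⟩ := exists_tip_eq q b
  have hpy : p.1 ∉ Metric.ball y 2 := by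
    intro hmem
    have h1 : ‖p.1 - y‖ < 2 := by rw [← dist_eq_norm]; exact hmem
    have h2 : ‖r • dir φ‖ = r := by rw [norm_smul, norm_dir, Real.norm_of_nonneg (by linarith), mul_one]
    have h3 := norm_add_le (p.1 - y) (y - (p.1 + r • dir φ))
    rw [sub_add_sub_cancel, sub_add_cancel_left, norm_neg, h2] at h3
    linarith
  have hqp : q ≠ p := by
    rintro rfl
    exact hpy (Metric.ball_subset_ball (by norm_num) hqy)
  have habs := abs_le.1 ha
  have hblock : IsBlockedAt X ℓ p σ (r + a) := by
    refine ⟨q, hq, hqp, σ', |b|, abs_nonneg b, by linarith, ?_, ?_⟩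
    · refine hℓ.le_of_isolated hq σ' fun p' hp' hd => huniq p' hp' ?_
      have := dist_triangle p'.1 q.1 y
      rw [Metric.mem_ball] at hqy ⊢
      linarith
    · rw [hσ', hφ, add_smul, ← add_assoc]
      rw [sub_eq_iff_eq_add] at hab
      rw [hab]
      abel
  refine (hℓ.le_of_isBlockedAt hp hblock).trans (ENNReal.ofReal_le_ofReal ?_)
  linarith

/-- In every direction, a branch that starts close to `u` runs into an obstacle soon after one of
the distances `5, 10, …, 5 k`. -/
def IsSurrounded (k : ℕ) (u : Plane) (X : Set MarkedPoint) : Prop :=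
  0 < k ∧ ∀ i < 448 * k, ∃ j < k,
    HasObstacle (u + (5 * (j + 1 : ℝ)) • dir (i / (64 * k))) (i / (64 * k)) X

/-- The mesh `1 / (64 * k)` limits the drift from the nearest ray to `5/64` over distances up to `5
* k`, and `448 * k` mesh steps span an angle `7 > 2 * π`. The discs are centred at distance at least
5 from `u`, so inserting `p` does not spoil the isolation of an obstacle. -/
theorem IsGrowth.le_of_isSurrounded {X : Set MarkedPoint} {ℓ : MarkedPoint → Side → ℝ≥0∞}
    {p : MarkedPoint} (hℓ : IsGrowth (insert p X) ℓ) (hp : p.2 ∈ Set.Ico 0 Real.pi) (σ : Side)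
    {k : ℕ} {u : Plane} (hpu : dist p.1 u ≤ 1 / 16) (h : IsSurrounded k u X) :
    ℓ p σ ≤ ENNReal.ofReal (5 * k + 1) := by
  obtain ⟨hk, h⟩ := h
  obtain ⟨φ, h0, h1, hφ⟩ := exists_angle p hp σ
  have hk' : (1 : ℝ) ≤ k := by exact_mod_cast hk
  have hn := Nat.floor_le (a := φ * (64 * k)) (by positivity)
  have hn' := Nat.lt_floor_add_one (φ * (64 * k))
  set i := ⌊φ * (64 * k)⌋₊
  have hi : i < 448 * k := by
    have : φ < 7 := by linarith [Real.pi_lt_d2]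
    have : (i : ℝ) < 448 * k := by nlinarith
    exact_mod_cast this
  have hdiff : |φ - i / (64 * k)| ≤ 1 / (64 * k) := by
    rw [abs_of_nonneg, sub_le_iff_le_add, ← add_div, le_div_iff₀ (by positivity)]
    · linarith
    · rw [sub_nonneg, div_le_iff₀ (by positivity)]
      exact hn
  obtain ⟨j, hj, hobs⟩ := h i hi
  have hj' : (j : ℝ) + 1 ≤ k := by exact_mod_cast hj
  have hj0 : (0 : ℝ) ≤ j := j.cast_nonneg
  have hd : k * |φ - i / (64 * k)| ≤ 1 / 64 := by
    calc k * |φ - i / (64 * k)| ≤ k * (1 / (64 * k)) := by gcongr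
      _ = 1 / 64 := by field_simp
  have habs := abs_nonneg (φ - i / (64 * k))
  have hθ : |φ - i / (64 * k)| ≤ 1 / 64 := by nlinarith
  have hrθ : 5 * ((j : ℝ) + 1) * |φ - i / (64 * k)| ≤ 5 / 64 := by nlinarith
  have hfar : p.1 ∉ Metric.ball (u + (5 * (j + 1 : ℝ)) • dir (i / (64 * k))) 2 := by
    intro hmem
    have h2 := dist_triangle_left u (u + (5 * (j + 1 : ℝ)) • dir (i / (64 * k))) p.1
    rw [dist_self_add_right, norm_smul, norm_dir, Real.norm_of_nonneg (by positivity)] at h2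
    rw [Metric.mem_ball] at hmem
    linarith
  refine (hℓ.le_of_hasObstacle (Set.mem_insert _ _) hφ (by linarith) hpu hθ hrθ
    (hobs.insert hfar)).trans (ENNReal.ofReal_le_ofReal (by linarith))

/-! ### Deterministic stabilization -/

theorem ξ_le_of_isSurrounded {X : Set MarkedPoint} {p : MarkedPoint}
    (hX : IsLocallyFinite (insert p X)) (hp : p.2 ∈ Set.Ico 0 Real.pi) (σ : Side)
    {k : ℕ} {u : Plane} (hpu : dist p.1 u ≤ 1 / 16) (h : IsSurrounded k u X) :
    ξ σ p X ≤ ENNReal.ofReal (5 * k + 1) :=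
  hX.isGrowth.le_of_isSurrounded hp σ hpu h

theorem ξ_eq_of_locally_eq {X Y : Set MarkedPoint} {p : MarkedPoint}
    (hX : IsLocallyFinite (insert p X)) (hY : IsLocallyFinite (insert p Y)) (σ : Side) {s : ℝ}
    (hs : ξ σ p X < ENNReal.ofReal s)
    (h : ∀ q : MarkedPoint, dist q.1 p.1 ≤ 2 * s → (q ∈ X ↔ q ∈ Y)) : ξ σ p X = ξ σ p Y :=
  eq_of_locally_eq hX.isGrowth hY.isGrowth hX (Set.mem_insert _ _) (Set.mem_insert _ _) σ hs
    fun q hq => by simp only [Set.mem_insert_iff, h q hq]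

theorem ξ_restrictTo {X : Set MarkedPoint} {p : MarkedPoint}
    (hX : IsLocallyFinite (insert p X)) (σ : Side) {s ρ : ℝ} (hs : ξ σ p X < ENNReal.ofReal s)
    (hρ : 2 * s ≤ ρ) : ξ σ p (restrictTo X (Metric.closedBall p.1 ρ)) = ξ σ p X :=
  (ξ_eq_of_locally_eq (Y := restrictTo X (Metric.closedBall p.1 ρ)) hX (hX.mono (Set.insert_subset_insert fun _ h => h.1)) σ hs fun _ hq =>
    ⟨fun h => ⟨h, Metric.mem_closedBall.2 (hq.trans hρ)⟩, fun h => h.1⟩).symm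

theorem ξ_restrictTo_union {X : Set MarkedPoint} (hX : IsLocallyFinite X) {p : MarkedPoint}
    (hp : ∀ q ∈ X, q.1 ≠ p.1) (σ : Side) {s : ℝ} (hs : ξ σ p X < ENNReal.ofReal s)
    {A : Set MarkedPoint} (hA : A.Finite) (hinj : Set.InjOn Prod.fst A)
    (hAp : ∀ q ∈ A, q.1 ∉ Metric.closedBall p.1 (2 * s)) :
    ξ σ p (restrictTo X (Metric.closedBall p.1 (2 * s)) ∪ A) = ξ σ p X := by
  have hs0 : 0 ≤ s := by
    by_contra! h
    simp [ENNReal.ofReal_of_nonpos h.le] at hs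
  refine (ξ_eq_of_locally_eq (hX.insert hp) ?_ σ hs fun q hq => ?_).symm
  · refine IsLocallyFinite.insert (isLocallyFinite_of_finite ((hX.finite _ _).union hA) ?_) ?_
    · rintro q (hq | hq) q' (hq' | hq') h
      · exact hX.injOn hq.1 hq'.1 h
      · exact absurd (h ▸ hq.2) (hAp q' hq')
      · exact absurd (h ▸ hq'.2) (hAp q hq)
      · exact hinj hq hq' h
    · rintro q (hq | hq) h
      · exact hp q hq.1 h
      · refine hAp q hq ?_
        rw [h]
        exact Metric.mem_closedBall_self (by linarith)
  · refine ⟨fun h => Or.inl ⟨h, Metric.mem_closedBall.2 hq⟩, ?_⟩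
    rintro (h | h)
    · exact h.1
    · exact absurd (Metric.mem_closedBall.2 hq) (hAp q h)

theorem tessellation_eq {X : Set MarkedPoint} (h : ∀ p ∈ X, ∀ σ, ξ σ p X ≠ ∞) :
    tessellation X = ⋃ p ∈ X, ⋃ σ : Side, segment ℝ p.1 (tip p σ (ξ σ p X).toReal) := by
  ext z
  simp only [tessellation, Set.mem_ofPred_eq, Set.mem_iUnion, exists_prop]
  refine exists_congr fun p => and_congr_right fun hp => exists_congr fun σ => ?_
  have hξ : branchLength X p σ = ξ σ p X := by rw [ξ, Set.insert_eq_of_mem hp]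
  rw [hξ, segment_eq_image']
  set L := (ξ σ p X).toReal with hL
  have hL0 : 0 ≤ L := ENNReal.toReal_nonneg
  have hlin : ∀ c : ℝ, p.1 + c • (tip p σ L - p.1) = tip p σ (c * L) := by
    intro c
    simp only [tip, add_sub_cancel_left, smul_smul]
    congr 2
    ring
  simp only [hlin, Set.mem_image]
  constructor
  · rintro ⟨t, h0, h1, rfl⟩
    rw [ENNReal.ofReal_le_iff_le_toReal (h p hp σ)] at h1
    rcases hL0.eq_or_lt with h2 | h2
    · exact ⟨0, by simp, by rw [show t = 0 by linarith]; simp⟩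
    · exact ⟨t / L, ⟨by positivity, (div_le_one h2).2 h1⟩, by rw [div_mul_cancel₀ _ h2.ne']⟩
  · rintro ⟨c, ⟨h0, h1⟩, rfl⟩
    refine ⟨c * L, by positivity, ?_, rfl⟩
    rw [ENNReal.ofReal_le_iff_le_toReal (h p hp σ)]
    exact mul_le_of_le_one_left hL0 h1

variable {Ω : Type*} [MeasurableSpace Ω]

/-! ### Counts of a Poisson process -/

theorem IsPoissonProcess.measure_encard_eq {P : Measure Ω} {τ : ℝ≥0} {Q : Ω → Set Plane}
    (hQ : IsPoissonProcess P τ Q) {B : Set Plane} (hB : MeasurableSet B)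
    (hb : Bornology.IsBounded B) (n : ℕ) :
    P {ω | (Q ω ∩ B).encard = n} = poissonMeasure (τ * (volume B).toNNReal) {n} := by
  rw [(hQ.count_law B hB hb).measure_eq (p := fun k => k = (n : ℕ∞)) (measurableSet_singleton _),
    Measure.map_apply .of_discrete .of_discrete]
  congr 1
  ext m
  simp

theorem IsPoissonProcess.ae_finite {P : Measure Ω} {τ : ℝ≥0} {Q : Ω → Set Plane}
    (hQ : IsPoissonProcess P τ Q) {B : Set Plane} (hB : MeasurableSet B)
    (hb : Bornology.IsBounded B) : ∀ᵐ ω ∂P, (Q ω ∩ B).Finite := by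
  have h : P {ω | (Q ω ∩ B).encard = ⊤} = 0 := by
    rw [(hQ.count_law B hB hb).measure_eq (p := fun k => k = (⊤ : ℕ∞)) (measurableSet_singleton _),
      Measure.map_apply .of_discrete .of_discrete]
    convert measure_empty (μ := poissonMeasure (τ * (volume B).toNNReal))
    ext m
    simp
  filter_upwards [measure_eq_zero_iff_ae_notMem.1 h] with ω hω
  exact Set.encard_ne_top_iff.1 hω

/-- A point has area zero, so its count is Poisson with parameter 0. -/
theorem IsPoissonProcess.ae_notMem {P : Measure Ω} [IsProbabilityMeasure P] {τ : ℝ≥0}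
    {Q : Ω → Set Plane} (hQ : IsPoissonProcess P τ Q) (z : Plane) : ∀ᵐ ω ∂P, z ∉ Q ω := by
  have hlaw := hQ.count_law {z} (measurableSet_singleton z) Bornology.isBounded_singleton
  have h := hQ.measure_encard_eq (measurableSet_singleton z) Bornology.isBounded_singleton 0
  have h0 : P {ω | (Q ω ∩ {z}).encard = (0 : ℕ)} = 1 := by
    rw [h, poissonMeasure_singleton]
    simp
  have hnull : NullMeasurableSet {ω | (Q ω ∩ {z}).encard = (0 : ℕ)} P :=
    hlaw.aemeasurable.nullMeasurableSet_preimage (measurableSet_singleton _)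
  have hae := (prob_compl_eq_zero_iff₀ hnull).2 h0
  filter_upwards [measure_eq_zero_iff_ae_notMem.1 hae] with ω hω hz
  simp only [Nat.cast_zero, Set.mem_compl_iff, Set.mem_ofPred_eq, not_not,
    Set.encard_eq_zero] at hω
  exact (Set.eq_empty_iff_forall_notMem.1 hω z) ⟨hz, rfl⟩

theorem IsPoissonProcess.iIndepFun_count {P : Measure Ω} {τ : ℝ≥0} {Q : Ω → Set Plane}
    (hQ : IsPoissonProcess P τ Q) {ι : Type*} [Fintype ι] (B : ι → Set Plane)
    (hB : ∀ i, MeasurableSet (B i)) (hb : ∀ i, Bornology.IsBounded (B i))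
    (hd : Pairwise (fun i j => Disjoint (B i) (B j))) :
    iIndepFun (fun i ω => (Q ω ∩ B i).encard) P := by
  let e := Fintype.equivFin ι
  have h := hQ.count_indep _ (fun k => B (e.symm k)) (fun k => hB _) (fun k => hb _)
    (fun k l hkl => hd (e.symm.injective.ne hkl))
  simpa using h.precomp e.injective

theorem measure_biInter_iInter_of_prod {P : Measure Ω} {ι κ β : Type*} [Fintype κ]
    [MeasurableSpace β] {f : ι × κ → Ω → β} (hf : iIndepFun f P) {s : ι × κ → Set β}
    (hs : ∀ j, MeasurableSet (s j)) (S : Finset ι) :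
    P (⋂ i ∈ S, ⋂ k, f (i, k) ⁻¹' s (i, k)) = ∏ i ∈ S, ∏ k, P (f (i, k) ⁻¹' s (i, k)) := by
  rw [← Finset.prod_product', ← hf.meas_biInter (S := S ×ˢ Finset.univ)
    (s := fun j => f j ⁻¹' s j) fun j _ => ⟨s j, hs j, rfl⟩]
  congr 1
  ext ω
  simp
  tauto

theorem measure_iInter_of_prod {P : Measure Ω} {ι κ β : Type*} [Fintype κ]
    [MeasurableSpace β] {f : ι × κ → Ω → β} (hf : iIndepFun f P) {s : ι × κ → Set β}
    (hs : ∀ j, MeasurableSet (s j)) (i : ι) :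
    P (⋂ k, f (i, k) ⁻¹' s (i, k)) = ∏ k, P (f (i, k) ⁻¹' s (i, k)) := by
  simpa using measure_biInter_iInter_of_prod hf hs {i}

/-- Independence by blocks: `ι` will index the discs and `κ` the two regions of a disc. -/
theorem iIndepSet_iInter_of_prod {P : Measure Ω} {ι κ β : Type*} [Fintype κ]
    [MeasurableSpace β] {f : ι × κ → Ω → β}
    (hf : iIndepFun f P) {s : ι × κ → Set β} (hs : ∀ j, MeasurableSet (s j))
    (hfs : ∀ j, MeasurableSet (f j ⁻¹' s j)) :
    iIndepSet (fun i => ⋂ k, f (i, k) ⁻¹' s (i, k)) P := by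
  rw [iIndepSet_iff_meas_biInter fun i => MeasurableSet.iInter fun k => hfs (i, k)]
  intro S
  simp only [measure_biInter_iInter_of_prod hf hs, measure_iInter_of_prod hf hs]

/-! ### Marks -/

instance : IsProbabilityMeasure markLaw :=
  cond_isProbabilityMeasure_of_finite (by simp [Real.pi_pos]) (by simp)

theorem ae_mem_Ico_of_hasLaw {P : Measure Ω} {a : Ω → ℝ} (ha : HasLaw a markLaw P) :
    ∀ᵐ ω ∂P, a ω ∈ Set.Ico 0 Real.pi := by
  refine ae_of_ae_map ha.aemeasurable ?_
  rw [ha.map_eq]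
  exact ae_cond_mem measurableSet_Ico

theorem measurableSet_transversal (θ : ℝ) :
    MeasurableSet {β : ℝ | 1 / 2 + 1 / 64 ≤ |Real.sin (β - θ)|} :=
  measurableSet_le measurable_const (by fun_prop)

theorem le_markLaw_of_Icc_subset {s : Set ℝ} {b : ℝ} (hb : 0 ≤ b) (hb' : b + 1 / 8 < Real.pi)
    (hs : Set.Icc b (b + 1 / 8) ⊆ s) : ENNReal.ofReal (1 / 32) ≤ markLaw s := by
  rw [markLaw, cond_apply measurableSet_Ico]
  have h1 : volume (Set.Icc b (b + 1 / 8)) ≤ volume (Set.Ico 0 Real.pi ∩ s) :=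
    measure_mono fun x hx => ⟨⟨hb.trans hx.1, hx.2.trans_lt hb'⟩, hs hx⟩
  rw [Real.volume_Icc, add_sub_cancel_left] at h1
  refine le_trans ?_ (mul_le_mul_right h1 _)
  rw [Real.volume_Ico, sub_zero, ← ENNReal.ofReal_inv_of_pos Real.pi_pos,
    ← ENNReal.ofReal_mul (by positivity)]
  refine ENNReal.ofReal_le_ofReal ?_
  have : (4 : ℝ)⁻¹ ≤ Real.pi⁻¹ := inv_anti₀ Real.pi_pos Real.pi_le_four
  linarith

/-- One of `|sin θ|`, `|cos θ|` is at least `7/10`, so the mark `0` or the mark `π / 2` is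
transversal with room to spare. Since `sin` is 1-Lipschitz, an interval of length `1/8` starting
there still gives `7/10 - 1/8 ≥ 1/2 + 1/64`; its probability is `1 / (8 * π) ≥ 1/32`. -/
theorem le_markLaw_transversal (θ : ℝ) :
    ENNReal.ofReal (1 / 32) ≤ markLaw {β | 1 / 2 + 1 / 64 ≤ |Real.sin (β - θ)|} := by
  have key : ∀ b, 0 ≤ b → b + 1 / 8 < Real.pi → 7 / 10 ≤ |Real.sin (b - θ)| →
      ENNReal.ofReal (1 / 32) ≤ markLaw {β | 1 / 2 + 1 / 64 ≤ |Real.sin (β - θ)|} := by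
    intro b h0 h1 h2
    refine le_markLaw_of_Icc_subset h0 h1 fun β hβ => ?_
    have h3 := Real.abs_sin_sub_sin_le (b - θ) (β - θ)
    have h4 := abs_sub_abs_le_abs_sub (Real.sin (b - θ)) (Real.sin (β - θ))
    have h5 : |b - θ - (β - θ)| ≤ 1 / 8 := by
      rw [abs_le]
      constructor <;> linarith [hβ.1, hβ.2]
    simp only [Set.mem_ofPred_eq]
    linarith
  by_cases h : 7 / 10 ≤ |Real.sin θ|
  · refine key 0 le_rfl (by linarith [Real.pi_gt_three]) ?_
    rwa [zero_sub, Real.sin_neg, abs_neg]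
  · refine key (Real.pi / 2) (by positivity) (by linarith [Real.pi_gt_three]) ?_
    rw [Real.sin_pi_div_two_sub]
    push Not at h
    by_contra! h'
    have h1 := sq_abs (Real.sin θ)
    have h2 := sq_abs (Real.cos θ)
    nlinarith [Real.sin_sq_add_cos_sq θ, abs_nonneg (Real.sin θ), abs_nonneg (Real.cos θ)]

/-! ### Almost sure properties of the marked process -/

theorem IsMarkedPoissonProcess.ae_isLocallyFinite {P : Measure Ω} {τ : ℝ≥0} {x : ℕ → Ω → Plane}
    {α : ℕ → Ω → ℝ} (h : IsMarkedPoissonProcess P τ x α) :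
    ∀ᵐ ω ∂P, IsLocallyFinite (markedProcess x α ω) := by
  have hfin : ∀ᵐ ω ∂P, ∀ N : ℕ,
      ((Set.range fun n => x n ω) ∩ Metric.closedBall 0 (N : ℝ)).Finite :=
    ae_all_iff.2 fun N =>
      h.poisson.ae_finite Metric.isClosed_closedBall.measurableSet Metric.isBounded_closedBall
  filter_upwards [hfin, h.ae_injective] with ω hω hinj
  have hinj' : Set.InjOn Prod.fst (markedProcess x α ω) := by
    rintro _ ⟨n, rfl⟩ _ ⟨m, rfl⟩ hnm
    rw [hinj hnm]
  refine ⟨hinj', fun y r => ?_⟩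
  obtain ⟨N, hN⟩ := exists_nat_ge (r + dist y 0)
  refine Set.Finite.of_finite_image (f := Prod.fst) ((hω N).subset ?_)
    (hinj'.mono fun _ hp => hp.1)
  rintro _ ⟨_, ⟨⟨n, rfl⟩, hp⟩, rfl⟩
  exact ⟨⟨n, rfl⟩, Metric.closedBall_subset_closedBall' hN hp⟩

theorem IsMarkedPoissonProcess.ae_fst_ne {P : Measure Ω} [IsProbabilityMeasure P] {τ : ℝ≥0}
    {x : ℕ → Ω → Plane} {α : ℕ → Ω → ℝ} (h : IsMarkedPoissonProcess P τ x α) (z : Plane) :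
    ∀ᵐ ω ∂P, ∀ q ∈ markedProcess x α ω, q.1 ≠ z := by
  filter_upwards [h.poisson.ae_notMem z] with ω hω
  rintro _ ⟨n, rfl⟩ hn
  exact hω ⟨n, hn⟩

theorem IsMarkedPoissonProcess.measurableSet_hasObstacle {P : Measure Ω} {τ : ℝ≥0}
    {x : ℕ → Ω → Plane} {α : ℕ → Ω → ℝ} (h : IsMarkedPoissonProcess P τ x α) (y : Plane) (θ : ℝ) :
    MeasurableSet {ω | HasObstacle y θ (markedProcess x α ω)} := by
  have hx := h.measurable_point
  have hα := h.measurable_mark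
  have e : {ω | HasObstacle y θ (markedProcess x α ω)} = ⋃ n,
      (x n ⁻¹' Metric.ball y (1 / 4)) ∩
      (α n ⁻¹' {β | 1 / 2 + 1 / 64 ≤ |Real.sin (β - θ)|} ∩
      ⋂ m, (x m ⁻¹' Metric.ball y 2)ᶜ ∪ {ω | (x m ω, α m ω) = (x n ω, α n ω)}) := by
    ext ω
    simp only [HasObstacle, markedProcess, Set.exists_range_iff, Set.forall_mem_range,
      Set.mem_iUnion, Set.mem_inter_iff, Set.mem_preimage, Set.mem_iInter, Set.mem_union,
      Set.mem_compl_iff, Set.mem_ofPred_eq, ← imp_iff_not_or]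
  rw [e]
  refine MeasurableSet.iUnion fun n => ((hx n) Metric.isOpen_ball.measurableSet).inter
    (((hα n) (measurableSet_transversal θ)).inter (MeasurableSet.iInter fun m =>
      ((hx m) Metric.isOpen_ball.measurableSet).compl.union ?_))
  exact measurableSet_eq_fun ((hx m).prodMk (hα m)) ((hx n).prodMk (hα n))

theorem IsMarkedPoissonProcess.measurableSet_isSurrounded {P : Measure Ω} {τ : ℝ≥0}
    {x : ℕ → Ω → Plane} {α : ℕ → Ω → ℝ} (h : IsMarkedPoissonProcess P τ x α) (k : ℕ) (u : Plane) :
    MeasurableSet {ω | IsSurrounded k u (markedProcess x α ω)} := by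
  have e : {ω | IsSurrounded k u (markedProcess x α ω)} = {_ω | 0 < k} ∩
      ⋂ i, ⋂ (_ : i < 448 * k), ⋃ j, ⋃ (_ : j < k), {ω | HasObstacle
        (u + (5 * (j + 1 : ℝ)) • dir (i / (64 * k))) (i / (64 * k)) (markedProcess x α ω)} := by
    ext ω
    simp only [IsSurrounded, Set.mem_ofPred_eq, Set.mem_inter_iff, Set.mem_iInter, Set.mem_iUnion,
      exists_prop]
  rw [e]
  exact (MeasurableSet.const _).inter (MeasurableSet.iInter fun i => MeasurableSet.iInter fun _ =>
    MeasurableSet.iUnion fun j => MeasurableSet.iUnion fun _ => h.measurableSet_hasObstacle _ _)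

/-! ### The probability of meeting no obstacle -/

/-- The small disc around `y` and the annulus that surrounds it. -/
def obstacleRegion (y : Plane) : Bool → Set Plane
  | true => Metric.ball y (1 / 4)
  | false => Metric.ball y 2 \ Metric.ball y (1 / 4)

/-- The numbers of seeds that an obstacle requires in the regions. -/
def obstacleCount : Bool → ℕ
  | true => 1
  | false => 0

theorem measurableSet_obstacleRegion (y : Plane) (b : Bool) :
    MeasurableSet (obstacleRegion y b) := by
  cases b
  · exact Metric.isOpen_ball.measurableSet.diff Metric.isOpen_ball.measurableSet
  · exact Metric.isOpen_ball.measurableSet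

theorem obstacleRegion_subset (y : Plane) (b : Bool) :
    obstacleRegion y b ⊆ Metric.ball y 2 := by
  cases b
  · exact Set.sdiff_subset
  · exact Metric.ball_subset_ball (by norm_num)

theorem volume_obstacleRegion (y : Plane) (b : Bool) :
    volume (obstacleRegion y b) = volume (obstacleRegion 0 b) := by
  cases b
  · have hsub : ∀ z : Plane, Metric.ball z (1 / 4) ⊆ Metric.ball z 2 :=
      fun z => Metric.ball_subset_ball (by norm_num)
    simp only [obstacleRegion]
    rw [measure_sdiff (hsub y) Metric.isOpen_ball.measurableSet.nullMeasurableSet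
        measure_ball_lt_top.ne,
      measure_sdiff (hsub 0) Metric.isOpen_ball.measurableSet.nullMeasurableSet
        measure_ball_lt_top.ne, Measure.addHaar_ball_center, Measure.addHaar_ball_center volume y]
  · exact Measure.addHaar_ball_center _ _ _

/-- A lower bound for the probability of an obstacle at a given place. -/
def obstacleProb (τ : ℝ≥0) : ℝ :=
  1 / 32 * ∏ b, (poissonMeasure (τ * (volume (obstacleRegion 0 b)).toNNReal)).real {obstacleCount b}

theorem obstacleProb_pos {τ : ℝ≥0} (hτ : 0 < τ) : 0 < obstacleProb τ := by
  have h : 0 < (volume (obstacleRegion 0 true)).toNNReal :=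
    ENNReal.toNNReal_pos (Metric.measure_ball_pos _ _ (by norm_num)).ne' measure_ball_lt_top.ne
  rw [obstacleProb, Fintype.prod_bool]
  have h1 := poissonMeasure_real_singleton_pos (obstacleCount true) (mul_pos hτ h)
  have h2 : 0 < (poissonMeasure (τ * (volume (obstacleRegion 0 false)).toNNReal)).real
      {obstacleCount false} := by
    rw [poissonMeasure_real_singleton]
    simp [obstacleCount, Real.exp_pos]
  positivity

theorem obstacleProb_le_one (τ : ℝ≥0) : obstacleProb τ ≤ 1 := by
  have : ∏ b, (poissonMeasure (τ * (volume (obstacleRegion 0 b)).toNNReal)).real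
      {obstacleCount b} ≤ 1 :=
    Finset.prod_le_one (fun _ _ => measureReal_nonneg) fun _ _ => measureReal_le_one
  rw [obstacleProb]
  linarith

theorem measurableSet_encard_range_inter_eq {x : ℕ → Ω → Plane} (hx : ∀ n, Measurable (x n))
    {B : Set Plane} (hB : MeasurableSet B) (b : Bool) :
    MeasurableSet {ω | ((Set.range fun n => x n ω) ∩ B).encard = obstacleCount b} := by
  cases b
  · have e : {ω | ((Set.range fun n => x n ω) ∩ B).encard = obstacleCount false} =
        ⋂ n, (x n ⁻¹' B)ᶜ := by
      ext ω
      simp [obstacleCount, Set.eq_empty_iff_forall_notMem]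
    rw [e]
    exact MeasurableSet.iInter fun n => (hx n hB).compl
  · have e : {ω | ((Set.range fun n => x n ω) ∩ B).encard = obstacleCount true} =
        ⋃ n, (x n ⁻¹' B) ∩ ⋂ m, (x m ⁻¹' B)ᶜ ∪ {ω | x m ω = x n ω} := by
      ext ω
      simp only [obstacleCount, Nat.cast_one, Set.encard_eq_one, Set.mem_ofPred_eq, Set.mem_iUnion,
        Set.mem_inter_iff, Set.mem_preimage, Set.mem_iInter, Set.mem_union, Set.mem_compl_iff,
        ← imp_iff_not_or]
      constructor
      · rintro ⟨a, ha⟩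
        obtain ⟨⟨n, hn⟩, hnB⟩ : a ∈ (Set.range fun n => x n ω) ∩ B := ha ▸ rfl
        subst hn
        exact ⟨n, hnB, fun m hm => by
          have : x m ω ∈ (Set.range fun n => x n ω) ∩ B := ⟨⟨m, rfl⟩, hm⟩
          rwa [ha] at this⟩
      · rintro ⟨n, hn, h⟩
        refine ⟨x n ω, Set.Subset.antisymm ?_ ?_⟩
        · rintro _ ⟨⟨m, rfl⟩, hm⟩
          exact h m hm
        · rintro _ rfl
          exact ⟨⟨n, rfl⟩, hn⟩
    rw [e]
    exact MeasurableSet.iUnion fun n => (hx n hB).inter (MeasurableSet.iInter fun m =>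
      (hx m hB).compl.union (measurableSet_eq_fun (hx m) (hx n)))

/-- The event that there is precisely one seed in the disc of radius `2` around `y`, and that this
seed is close to `y`. -/
def isolatedSeed (x : ℕ → Ω → Plane) (y : Plane) : Set Ω :=
  ⋂ b, {ω | ((Set.range fun n => x n ω) ∩ obstacleRegion y b).encard = obstacleCount b}

theorem measurableSet_isolatedSeed {x : ℕ → Ω → Plane} (hx : ∀ n, Measurable (x n)) (y : Plane) :
    MeasurableSet (isolatedSeed x y) :=
  MeasurableSet.iInter fun b =>
    measurableSet_encard_range_inter_eq hx (measurableSet_obstacleRegion y b) b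

/-- Marks are attached to indices, so the unique location must be turned into a unique index. -/
theorem exists_of_mem_isolatedSeed {Ω : Type*} {x : ℕ → Ω → Plane} {y : Plane} {ω : Ω}
    (h : ω ∈ isolatedSeed x y) (hinj : Function.Injective fun n => x n ω) :
    ∃ n, x n ω ∈ Metric.ball y (1 / 4) ∧ ∀ m, x m ω ∈ Metric.ball y 2 → m = n := by
  rw [isolatedSeed, Set.mem_iInter] at h
  have h1 := h true
  have h0 := h false
  simp only [obstacleCount, obstacleRegion, Nat.cast_one, Nat.cast_zero, Set.mem_ofPred_eq,
    Set.encard_eq_one, Set.encard_eq_zero] at h0 h1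
  obtain ⟨a, ha⟩ := h1
  obtain ⟨⟨n, hn⟩, hnB⟩ : a ∈ (Set.range fun n => x n ω) ∩ Metric.ball y (1 / 4) := ha ▸ rfl
  subst hn
  refine ⟨n, hnB, fun m hm => ?_⟩
  by_cases hm' : x m ω ∈ Metric.ball y (1 / 4)
  · have : x m ω ∈ (Set.range fun n => x n ω) ∩ Metric.ball y (1 / 4) := ⟨⟨m, rfl⟩, hm'⟩
    rw [ha] at this
    exact hinj this
  · exact absurd ⟨⟨m, rfl⟩, hm, hm'⟩ (Set.eq_empty_iff_forall_notMem.1 h0 (x m ω))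

theorem IsPoissonProcess.iIndepFun_obstacleRegion {P : Measure Ω} {τ : ℝ≥0} {Q : Ω → Set Plane}
    (hQ : IsPoissonProcess P τ Q) {ι : Type*} [Fintype ι] {y : ι → Plane}
    (hy : Pairwise fun i j => Disjoint (Metric.ball (y i) 2) (Metric.ball (y j) 2)) :
    iIndepFun (fun (j : ι × Bool) ω => (Q ω ∩ obstacleRegion (y j.1) j.2).encard) P := by
  refine hQ.iIndepFun_count _ (fun j => measurableSet_obstacleRegion _ _)
    (fun j => Metric.isBounded_ball.subset (obstacleRegion_subset _ _)) ?_
  rintro ⟨i, b⟩ ⟨j, c⟩ hij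
  by_cases h : i = j
  · subst h
    have hbc : b ≠ c := fun h => hij (by rw [h])
    cases b <;> cases c <;> simp only [obstacleRegion, ne_eq, not_true_eq_false] at hbc ⊢
    · exact Set.disjoint_sdiff_left
    · exact Set.disjoint_sdiff_right
  · exact (hy h).mono (obstacleRegion_subset _ _) (obstacleRegion_subset _ _)

theorem IsMarkedPoissonProcess.iIndepSet_isolatedSeed {P : Measure Ω} {τ : ℝ≥0}
    {x : ℕ → Ω → Plane} {α : ℕ → Ω → ℝ} (h : IsMarkedPoissonProcess P τ x α) {ι : Type*}
    [Fintype ι] {y : ι → Plane}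
    (hy : Pairwise fun i j => Disjoint (Metric.ball (y i) 2) (Metric.ball (y j) 2)) :
    iIndepSet (fun i => isolatedSeed x (y i)) P :=
  iIndepSet_iInter_of_prod (h.poisson.iIndepFun_obstacleRegion hy)
    (s := fun j => {(obstacleCount j.2 : ℕ∞)}) (fun _ => measurableSet_singleton _)
    fun _ => measurableSet_encard_range_inter_eq h.measurable_point
      (measurableSet_obstacleRegion _ _) _

theorem IsMarkedPoissonProcess.measureReal_isolatedSeed {P : Measure Ω} {τ : ℝ≥0}
    {x : ℕ → Ω → Plane} {α : ℕ → Ω → ℝ} (h : IsMarkedPoissonProcess P τ x α) (y : Plane) :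
    1 / 32 * P.real (isolatedSeed x y) = obstacleProb τ := by
  have hind := h.poisson.iIndepFun_obstacleRegion (ι := Unit) (y := fun _ => y)
    fun i j hij => absurd (Subsingleton.elim i j) hij
  have key := measure_iInter_of_prod hind (s := fun j => {(obstacleCount j.2 : ℕ∞)})
    (fun _ => measurableSet_singleton _) ()
  have key' : P (isolatedSeed x y) = ∏ b, P {ω | ((Set.range fun n => x n ω) ∩
      obstacleRegion y b).encard = obstacleCount b} := key
  rw [measureReal_def, key', ENNReal.toReal_prod, obstacleProb]
  congr 1
  refine Finset.prod_congr rfl fun b _ => ?_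
  rw [h.poisson.measure_encard_eq (measurableSet_obstacleRegion y b)
    (Metric.isBounded_ball.subset (obstacleRegion_subset _ _)), volume_obstacleRegion,
    measureReal_def]

/-- Applied with the points frozen, so that the set of relevant indices is deterministic. -/
theorem IsMarkedPoissonProcess.measure_marks_le {P : Measure Ω} {τ : ℝ≥0}
    {x : ℕ → Ω → Plane} {α : ℕ → Ω → ℝ} (h : IsMarkedPoissonProcess P τ x α) (θ : ℝ)
    (S : Finset ℕ) :
    P {ω | ∀ n ∈ S, ¬ 1 / 2 + 1 / 64 ≤ |Real.sin (α n ω - θ)|} ≤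
      ENNReal.ofReal (31 / 32) ^ S.card := by
  have hJ := (measurableSet_transversal θ).compl
  have e : {ω | ∀ n ∈ S, ¬ 1 / 2 + 1 / 64 ≤ |Real.sin (α n ω - θ)|} =
      ⋂ n ∈ S, α n ⁻¹' {β | 1 / 2 + 1 / 64 ≤ |Real.sin (β - θ)|}ᶜ := by
    ext ω
    simp
  rw [e, h.mark_indep.meas_biInter fun n _ => ⟨_, hJ, rfl⟩]
  refine Finset.prod_le_pow_card _ _ _ fun n _ => ?_
  rw [← Measure.map_apply (h.measurable_mark n) hJ, (h.mark_law n).map_eq,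
    prob_compl_eq_one_sub (measurableSet_transversal θ)]
  refine (tsub_le_tsub_left (le_markLaw_transversal θ) 1).trans ?_
  rw [← ENNReal.ofReal_one, ← ENNReal.ofReal_sub _ (by norm_num)]
  norm_num

/-- The index of the seed in a disc is random, but it depends on the points only. Given the points,
disjoint discs select distinct indices, so their marks are independent and all fail to be
transversal with probability at most `31/32` to the number of discs with an isolated seed. That
power is a product over the discs, whose mean factorizes because the Poisson counts are independent.
-/
theorem IsMarkedPoissonProcess.measure_forall_not_hasObstacle_le {P : Measure Ω}
    [IsProbabilityMeasure P] {τ : ℝ≥0} {x : ℕ → Ω → Plane} {α : ℕ → Ω → ℝ}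
    (h : IsMarkedPoissonProcess P τ x α) {ι : Type*} [Fintype ι] {y : ι → Plane} (θ : ℝ)
    (hy : Pairwise fun i j => Disjoint (Metric.ball (y i) 2) (Metric.ball (y j) 2)) :
    P {ω | ∀ i, ¬ HasObstacle (y i) θ (markedProcess x α ω)} ≤
      ENNReal.ofReal ((1 - obstacleProb τ) ^ Fintype.card ι) := by
  classical
  have hxm : Measurable fun ω n => x n ω := measurable_pi_lambda _ h.measurable_point
  have hαm : Measurable fun ω n => α n ω := measurable_pi_lambda _ h.measurable_mark
  let J : Set ℝ := {β | 1 / 2 + 1 / 64 ≤ |Real.sin (β - θ)|}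
  have hJ : MeasurableSet J := measurableSet_transversal θ
  -- Absence of obstacles expressed through indices: a measurable set of pairs (points, marks), to
  -- which Fubini applies.
  let S : Set ((ℕ → Plane) × (ℕ → ℝ)) := ⋂ i, (⋃ n,
    {v | v.1 n ∈ Metric.ball (y i) (1 / 4)} ∩ ({v | v.2 n ∈ J} ∩
      ⋂ m, {v | v.1 m ∈ Metric.ball (y i) 2 → m = n}))ᶜ
  have hS : MeasurableSet S := by
    refine MeasurableSet.iInter fun i => (MeasurableSet.iUnion fun n => ?_).compl
    refine MeasurableSet.inter ?_ (MeasurableSet.inter ?_ (MeasurableSet.iInter fun m => ?_))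
    · exact (by fun_prop : Measurable fun v : (ℕ → Plane) × (ℕ → ℝ) => v.1 n)
        Metric.isOpen_ball.measurableSet
    · exact (by fun_prop : Measurable fun v : (ℕ → Plane) × (ℕ → ℝ) => v.2 n) hJ
    · by_cases hmn : m = n
      · simp [hmn]
      · simp only [hmn, imp_false]
        exact ((by fun_prop : Measurable fun v : (ℕ → Plane) × (ℕ → ℝ) => v.1 m)
          Metric.isOpen_ball.measurableSet).compl
  have hsub : P {ω | ∀ i, ¬ HasObstacle (y i) θ (markedProcess x α ω)} ≤
      P ((fun ω => ((fun n => x n ω), fun n => α n ω)) ⁻¹' S) := by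
    refine measure_mono fun ω hω => ?_
    simp only [S, Set.mem_preimage, Set.mem_iInter, Set.mem_compl_iff, Set.mem_iUnion,
      Set.mem_inter_iff, Set.mem_ofPred_eq]
    rintro i ⟨n, h1, h2, h3⟩
    refine hω i ⟨_, ⟨n, rfl⟩, h1, h2, ?_⟩
    rintro _ ⟨m, rfl⟩ hm
    rw [h3 m hm]
  refine hsub.trans ?_
  rw [← Measure.map_apply (hxm.prodMk hαm) hS, h.indep.map_prod_eq_prod_map_map hxm.aemeasurable
    hαm.aemeasurable, Measure.prod_apply hS, lintegral_map (measurable_measure_prodMk_left hS) hxm]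
  let g : ι → Ω → ℝ := fun i => (isolatedSeed x (y i)).indicator fun _ => 1
  have hgm : ∀ i, Measurable (g i) := fun i =>
    measurable_const.indicator (measurableSet_isolatedSeed h.measurable_point _)
  have hg01 : ∀ i ω, 0 ≤ 1 - 1 / 32 * g i ω ∧ 1 - 1 / 32 * g i ω ≤ 1 := by
    intro i ω
    by_cases hi : ω ∈ isolatedSeed x (y i) <;> simp [g, hi]; norm_num
  have hbound : ∀ᵐ ω ∂P, (P.map fun ω n => α n ω) (Prod.mk (fun n => x n ω) ⁻¹' S) ≤
      ENNReal.ofReal (∏ i, (1 - 1 / 32 * g i ω)) := by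
    filter_upwards [h.ae_injective] with ω hinj
    -- The implication stands inside the existential so that the chosen index is total in `i`, with
    -- an irrelevant value `0` for discs without an isolated seed.
    have hex : ∀ i, ∃ n, ω ∈ isolatedSeed x (y i) →
        x n ω ∈ Metric.ball (y i) (1 / 4) ∧ ∀ m, x m ω ∈ Metric.ball (y i) 2 → m = n := by
      intro i
      by_cases hi : ω ∈ isolatedSeed x (y i)
      · obtain ⟨n, hn⟩ := exists_of_mem_isolatedSeed hi hinj
        exact ⟨n, fun _ => hn⟩
      · exact ⟨0, fun h => absurd h hi⟩
    choose n hn using hex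
    let K : Finset ι := Finset.univ.filter fun i => ω ∈ isolatedSeed x (y i)
    have hK : ∀ i, i ∈ K ↔ ω ∈ isolatedSeed x (y i) := by simp [K]
    have hball : ∀ i ∈ K, x (n i) ω ∈ Metric.ball (y i) 2 := fun i hi =>
      Metric.ball_subset_ball (by norm_num) (hn i ((hK i).1 hi)).1
    have hninj : Set.InjOn n K := by
      intro i hi j hj hij
      by_contra hne
      have h1 := hball i hi
      rw [hij] at h1
      exact Set.disjoint_left.1 (hy hne) h1 (hball j hj)
    have hprod : ∏ i, (1 - 1 / 32 * g i ω) = (31 / 32) ^ (K.image n).card := by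
      rw [Finset.card_image_of_injOn hninj, ← Finset.prod_const,
        ← Finset.prod_subset (Finset.subset_univ K)]
      · refine Finset.prod_congr rfl fun i hi => ?_
        simp [g, (hK i).1 hi]
        norm_num
      · intro i _ hi
        simp [g, mt (hK i).2 hi]
    rw [hprod, ENNReal.ofReal_pow (by norm_num), Measure.map_apply hαm
      (measurable_prodMk_left hS)]
    refine (measure_mono fun ω' hω' => ?_).trans (h.measure_marks_le θ (K.image n))
    simp only [S, Set.mem_preimage, Set.mem_iInter, Set.mem_compl_iff, Set.mem_iUnion,
      Set.mem_inter_iff, Set.mem_ofPred_eq] at hω'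
    simp only [Finset.mem_image, Set.mem_ofPred_eq]
    rintro _ ⟨i, hi, rfl⟩ hJi
    have hni := hn i ((hK i).1 hi)
    exact hω' i ⟨n i, hni.1, hJi, hni.2⟩
  refine (lintegral_mono_ae hbound).trans ?_
  have hint : ∫ ω, ∏ i, (1 - 1 / 32 * g i ω) ∂P = (1 - obstacleProb τ) ^ Fintype.card ι := by
    have hind : iIndepFun g P := (h.iIndepSet_isolatedSeed hy).iIndepFun_indicator
    have h1 := hind.integral_fun_prod_comp (f := fun _ v => 1 - 1 / 32 * v)
      (fun i => (hgm i).aemeasurable)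
      (fun i => (by fun_prop : Measurable fun v : ℝ => 1 - 1 / 32 * v).aestronglyMeasurable)
    rw [h1, ← Finset.card_univ, ← Finset.prod_const]
    refine Finset.prod_congr rfl fun i _ => ?_
    have hgi : Integrable (g i) P :=
      (integrable_const 1).indicator (measurableSet_isolatedSeed h.measurable_point _)
    rw [integral_sub (integrable_const _) (hgi.const_mul _), integral_const_mul,
      ← h.measureReal_isolatedSeed (y i)]
    simp only [g]
    rw [integral_indicator_const _ (measurableSet_isolatedSeed h.measurable_point _)]
    simp
  have hgi : Integrable (fun ω => ∏ i, (1 - 1 / 32 * g i ω)) P := by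
    refine Integrable.of_bound (Measurable.aestronglyMeasurable ?_) 1 (ae_of_all _ fun ω => ?_)
    · exact Finset.measurable_fun_prod _ fun i _ => measurable_const.sub ((hgm i).const_mul _)
    · rw [Real.norm_of_nonneg (Finset.prod_nonneg fun i _ => (hg01 i ω).1)]
      exact Finset.prod_le_one (fun i _ => (hg01 i ω).1) fun i _ => (hg01 i ω).2
  rw [← hint, ofReal_integral_eq_lintegral_ofReal hgi
    (ae_of_all _ fun ω => Finset.prod_nonneg fun i _ => (hg01 i ω).1)]

/-! ### Exponential stabilization -/

/-- Half of the exponential decay pays for the linear factor. -/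
theorem mul_one_sub_pow_le {p : ℝ} (hp : 0 < p) (hp1 : p ≤ 1) (k : ℕ) :
    k * (1 - p) ^ k ≤ 2 / p * Real.exp (-(p / 2) * k) := by
  have h1 : (1 - p) ^ k ≤ Real.exp (-p * k) := by
    rw [mul_comm, Real.exp_nat_mul]
    exact pow_le_pow_left₀ (by linarith) (Real.one_sub_le_exp_neg p) k
  have h2 : (k : ℝ) ≤ 2 / p * Real.exp (p / 2 * k) := by
    have h := Real.add_one_le_exp (p / 2 * k)
    rw [div_mul_eq_mul_div, le_div_iff₀ hp]
    linarith
  calc k * (1 - p) ^ k ≤ 2 / p * Real.exp (p / 2 * k) * Real.exp (-p * k) := by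
        gcongr
    _ = 2 / p * Real.exp (-(p / 2) * k) := by
        rw [mul_assoc, ← Real.exp_add]
        ring_nf

theorem pairwise_disjoint_ball_ray (u : Plane) (θ : ℝ) (k : ℕ) :
    Pairwise fun i j : Fin k => Disjoint (Metric.ball (u + (5 * ((i : ℕ) + 1 : ℝ)) • dir θ) 2)
      (Metric.ball (u + (5 * ((j : ℕ) + 1 : ℝ)) • dir θ) 2) := by
  intro i j hij
  refine Metric.ball_disjoint_ball ?_
  rw [dist_add_left, dist_eq_norm, ← sub_smul, norm_smul, norm_dir, mul_one, Real.norm_eq_abs,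
    ← mul_sub, add_sub_add_right_eq_sub, abs_mul]
  have h : (1 : ℤ) ≤ |((i : ℕ) : ℤ) - ((j : ℕ) : ℤ)| :=
    Int.one_le_abs (sub_ne_zero.2 fun h => hij (Fin.ext (by exact_mod_cast h)))
  have h' : (1 : ℝ) ≤ |((i : ℕ) : ℝ) - ((j : ℕ) : ℝ)| := by exact_mod_cast h
  norm_num
  linarith

theorem IsMarkedPoissonProcess.measure_not_isSurrounded_le {P : Measure Ω}
    [IsProbabilityMeasure P] {τ : ℝ≥0} {x : ℕ → Ω → Plane} {α : ℕ → Ω → ℝ} (hτ : 0 < τ)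
    (h : IsMarkedPoissonProcess P τ x α) {k : ℕ} (hk : 0 < k) (u : Plane) :
    P {ω | ¬ IsSurrounded k u (markedProcess x α ω)} ≤
      ENNReal.ofReal (896 / obstacleProb τ * Real.exp (-(obstacleProb τ / 2) * k)) := by
  have hsub : {ω | ¬ IsSurrounded k u (markedProcess x α ω)} ⊆
      ⋃ i ∈ Finset.range (448 * k), {ω | ∀ j : Fin k, ¬ HasObstacle
        (u + (5 * ((j : ℕ) + 1 : ℝ)) • dir (i / (64 * k))) (i / (64 * k))
          (markedProcess x α ω)} := by
    intro ω hω
    simp only [IsSurrounded, hk, true_and, Set.mem_ofPred_eq] at hω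
    push Not at hω
    obtain ⟨i, hi, h⟩ := hω
    exact Set.mem_biUnion (Finset.mem_coe.2 (Finset.mem_range.2 hi)) fun j => h j j.2
  -- Union bound over the `448 * k` rays; the `k` discs on a ray are disjoint because their spacing
  -- 5 exceeds two radii.
  refine (measure_mono hsub).trans ((measure_biUnion_finset_le _ _).trans
    ((Finset.sum_le_card_nsmul _ _ _ fun i _ => h.measure_forall_not_hasObstacle_le _
      (pairwise_disjoint_ball_ray u _ k)).trans ?_))
  rw [Finset.card_range, Fintype.card_fin, nsmul_eq_mul, ← ENNReal.ofReal_natCast,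
    ← ENNReal.ofReal_mul (by positivity)]
  refine ENNReal.ofReal_le_ofReal ?_
  have := mul_one_sub_pow_le (obstacleProb_pos hτ) (obstacleProb_le_one τ) k
  calc ((448 * k : ℕ) : ℝ) * (1 - obstacleProb τ) ^ k
      = 448 * (k * (1 - obstacleProb τ) ^ k) := by push_cast; ring
    _ ≤ 448 * (2 / obstacleProb τ * Real.exp (-(obstacleProb τ / 2) * k)) := by gcongr
    _ = _ := by ring

theorem IsMarkedPoissonProcess.ae_exists_isSurrounded {P : Measure Ω}
    [IsProbabilityMeasure P] {τ : ℝ≥0} {x : ℕ → Ω → Plane} {α : ℕ → Ω → ℝ} (hτ : 0 < τ)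
    (h : IsMarkedPoissonProcess P τ x α) (u : Plane) :
    ∀ᵐ ω ∂P, ∃ k, IsSurrounded k u (markedProcess x α ω) := by
  have hp := obstacleProb_pos hτ
  have hlim : Tendsto (fun k : ℕ =>
      ENNReal.ofReal (896 / obstacleProb τ * Real.exp (-(obstacleProb τ / 2) * k))) atTop (𝓝 0) := by
    rw [← ENNReal.ofReal_zero, ← mul_zero (896 / obstacleProb τ)]
    refine ENNReal.tendsto_ofReal (Tendsto.const_mul _ (Real.tendsto_exp_atBot.comp ?_))
    exact tendsto_natCast_atTop_atTop.const_mul_atTop_of_neg (by linarith)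
  refine le_antisymm (ge_of_tendsto hlim ?_) zero_le
  filter_upwards [eventually_gt_atTop 0] with k hk
  refine (measure_mono fun ω hω => ?_).trans (h.measure_not_isSurrounded_le hτ hk u)
  exact fun hs => hω ⟨k, hs⟩

/-- A radius of stabilization of the branches emitted from `p`. -/
def stabilizationRadius (p : MarkedPoint) (X : Set MarkedPoint) : ℝ≥0 :=
  10 * (sInf {k | IsSurrounded k p.1 X} : ℕ) + 4

theorem IsMarkedPoissonProcess.measurable_stabilizationRadius {P : Measure Ω} {τ : ℝ≥0}
    {x : ℕ → Ω → Plane} {α : ℕ → Ω → ℝ} (h : IsMarkedPoissonProcess P τ x α) (z : Plane)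
    (a : Ω → ℝ) : Measurable fun ω => stabilizationRadius (z, a ω) (markedProcess x α ω) := by
  have hm : Measurable fun ω => sInf {k | IsSurrounded k z (markedProcess x α ω)} := by
    refine measurable_to_countable' fun n => ?_
    have e : (fun ω => sInf {k | IsSurrounded k z (markedProcess x α ω)}) ⁻¹' {n} =
        ({ω | IsSurrounded n z (markedProcess x α ω)} ∩
          ⋂ m, ⋂ (_ : m < n), {ω | IsSurrounded m z (markedProcess x α ω)}ᶜ) ∪
        -- The value `sInf ∅ = 0` when no `k` works; `IsSurrounded 0` itself never holds.
        ({_ω | n = 0} ∩ ⋂ m, {ω | IsSurrounded m z (markedProcess x α ω)}ᶜ) := by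
      ext ω
      simp only [Set.mem_preimage, Set.mem_singleton_iff, Set.mem_union, Set.mem_inter_iff,
        Set.mem_iInter, Set.mem_compl_iff, Set.mem_ofPred_eq]
      constructor
      · rintro rfl
        by_cases hne : {k | IsSurrounded k z (markedProcess x α ω)}.Nonempty
        · exact Or.inl ⟨Nat.sInf_mem hne, fun m hm => Nat.notMem_of_lt_sInf hm⟩
        · rw [Set.not_nonempty_iff_eq_empty] at hne
          refine Or.inr ⟨by rw [hne, Nat.sInf_empty], fun m hm => ?_⟩
          exact Set.eq_empty_iff_forall_notMem.1 hne m hm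
      · rintro (⟨h1, h2⟩ | ⟨h1, h2⟩)
        · refine le_antisymm (Nat.sInf_le h1) ?_
          by_contra! hlt
          exact h2 _ hlt (Nat.sInf_mem (s := {k | IsSurrounded k z (markedProcess x α ω)}) ⟨n, h1⟩)
        · have : {k | IsSurrounded k z (markedProcess x α ω)} = ∅ :=
            Set.eq_empty_iff_forall_notMem.2 h2
          rw [this, Nat.sInf_empty, h1]
    have hS := fun m => h.measurableSet_isSurrounded m z
    rw [e]
    exact ((hS n).inter (MeasurableSet.iInter fun m => MeasurableSet.iInter fun _ =>
      (hS m).compl)).union ((MeasurableSet.const _).inter (MeasurableSet.iInter fun m =>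
      (hS m).compl))
  have hc : Measurable fun n : ℕ => 10 * (n : ℝ≥0) + 4 := measurable_from_nat
  exact hc.comp hm

theorem IsMarkedPoissonProcess.measure_lt_stabilizationRadius_le {P : Measure Ω}
    [IsProbabilityMeasure P] {τ : ℝ≥0} {x : ℕ → Ω → Plane} {α : ℕ → Ω → ℝ} (hτ : 0 < τ)
    (h : IsMarkedPoissonProcess P τ x α) (z : Plane) (a : Ω → ℝ) (r : ℝ) :
    P {ω | r < (stabilizationRadius (z, a ω) (markedProcess x α ω) : ℝ)} ≤
      ENNReal.ofReal (896 / obstacleProb τ * Real.exp (obstacleProb τ * (14 / 20)) *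
        Real.exp (-(obstacleProb τ / 20) * r)) := by
  have hp := obstacleProb_pos hτ
  have hp1 := obstacleProb_le_one τ
  rw [mul_assoc, ← Real.exp_add]
  -- For `r < 14` the floor below may be zero, but then the claimed bound is at least 1.
  rcases lt_or_ge r 14 with hr | hr
  · refine prob_le_one.trans ?_
    rw [← ENNReal.ofReal_one]
    refine ENNReal.ofReal_le_ofReal (one_le_mul_of_one_le_of_one_le ?_ (Real.one_le_exp ?_))
    · rw [one_le_div hp]
      linarith
    · nlinarith
  -- With `k = ⌊(r - 4) / 10⌋₊`, a radius above `r` means that `k` lies below the infimum, so `k`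
  -- fails. As `k > (r - 14) / 10`, the decay rate `obstacleProb τ / 2` in `k` becomes `obstacleProb
  -- τ / 20` in `r`, and the shift 14 yields the factor with `14 / 20`.
  · have hk : 0 < ⌊(r - 4) / 10⌋₊ := Nat.floor_pos.2 (by linarith)
    have hk1 := Nat.floor_le (a := (r - 4) / 10) (by linarith)
    have hk2 := Nat.lt_floor_add_one ((r - 4) / 10)
    refine (measure_mono fun ω hω => ?_).trans ((h.measure_not_isSurrounded_le hτ hk z).trans
      (ENNReal.ofReal_le_ofReal ?_))
    · simp only [stabilizationRadius, NNReal.coe_add, NNReal.coe_mul, NNReal.coe_ofNat,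
        NNReal.coe_natCast, Set.mem_ofPred_eq] at hω
      refine Nat.notMem_of_lt_sInf (s := {k | IsSurrounded k z (markedProcess x α ω)}) ?_
      have : (⌊(r - 4) / 10⌋₊ : ℝ) <
          (sInf {k | IsSurrounded k z (markedProcess x α ω)} : ℕ) := by linarith
      exact_mod_cast this
    · gcongr
      nlinarith

/-- Half the radius is `5 * K + 2`, strictly above the bound `5 * K + 1`; the additive 4 provides
this strictness. -/
theorem ξ_lt_of_exists_isSurrounded {X : Set MarkedPoint} {p : MarkedPoint}
    (hX : IsLocallyFinite (insert p X)) (hp : p.2 ∈ Set.Ico 0 Real.pi) (σ : Side)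
    (h : ∃ k, IsSurrounded k p.1 X) :
    ξ σ p X < ENNReal.ofReal (stabilizationRadius p X / 2) := by
  have hk : IsSurrounded (sInf {k | IsSurrounded k p.1 X}) p.1 X := Nat.sInf_mem h
  refine (ξ_le_of_isSurrounded hX hp σ (by simp) hk).trans_lt ?_
  rw [ENNReal.ofReal_lt_ofReal_iff_of_nonneg (by positivity)]
  simp only [stabilizationRadius, NNReal.coe_add, NNReal.coe_mul, NNReal.coe_ofNat,
    NNReal.coe_natCast]
  linarith

/-- The exceptional null set depends on the origin and seeds are random, so the almost sure
statement is taken at a countable dense set of origins; each seed has one within the tolerance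
`1/16`. -/
theorem IsMarkedPoissonProcess.ae_forall_ξ_ne_top {P : Measure Ω}
    [IsProbabilityMeasure P] {τ : ℝ≥0} {x : ℕ → Ω → Plane} {α : ℕ → Ω → ℝ} (hτ : 0 < τ)
    (h : IsMarkedPoissonProcess P τ x α) :
    ∀ᵐ ω ∂P, ∀ p ∈ markedProcess x α ω, ∀ σ : Side, ξ σ p (markedProcess x α ω) ≠ ∞ := by
  filter_upwards [h.ae_isLocallyFinite, ae_all_iff.2 fun n => ae_mem_Ico_of_hasLaw (h.mark_law n),
    ae_all_iff.2 fun n => h.ae_exists_isSurrounded hτ (TopologicalSpace.denseSeq Plane n)]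
    with ω hlf hmark hsur p hp σ
  obtain ⟨n, hn⟩ := Metric.denseRange_iff.1 (TopologicalSpace.denseRange_denseSeq Plane) p.1
    (1 / 16) (by norm_num)
  obtain ⟨k, hk⟩ := hsur n
  have hp2 : p.2 ∈ Set.Ico 0 Real.pi := by
    obtain ⟨m, rfl⟩ := hp
    exact hmark m
  exact ((ξ_le_of_isSurrounded (by rwa [Set.insert_eq_of_mem hp]) hp2 σ hn.le hk).trans_lt
    ENNReal.ofReal_lt_top).ne

end Gilbert
end

/-! ### Exponential stabilization and the whole-plane tessellation -/

open MeasureTheory Filter Gilbert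
open scoped ENNReal NNReal

theorem theorem4 (τ : ℝ≥0) (hτ : 0 < τ) :
    ∃ C : ℝ, 0 < C ∧ ∃ M : ℝ, 0 < M ∧
    ∀ (Ω : Type*) [MeasurableSpace Ω] (P : Measure Ω) [IsProbabilityMeasure P]
      (x : ℕ → Ω → Plane) (α : ℕ → Ω → ℝ) (a : Ω → ℝ),
      IsMarkedPoissonProcess P τ x α → IsExtraMark P x α a →
      -- exponential stabilization of both functionals at every point of the plane
      (∀ σ : Side, ∃ R : MarkedPoint → Set MarkedPoint → ℝ≥0, ∀ z : Plane,
        IsStabilizationRadius (ξ σ) P (markedProcess x α) a z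
          (fun ω => R (z, a ω) (markedProcess x α ω)) ∧
        (∀ r : ℝ, 0 < r →
          P {ω | r < (R (z, a ω) (markedProcess x α ω) : ℝ)} ≤
            ENNReal.ofReal (M * Real.exp (-C * r))) ∧
        -- the whole-plane functional at `z` is well defined, a.s. finite, and is both the value
        -- inside the stabilization radius and the limit over growing windows
        ∀ᵐ ω ∂P,
          (∃! ℓ, IsGrowth (insert (z, a ω) (markedProcess x α ω)) ℓ) ∧
          ξ σ (z, a ω) (markedProcess x α ω) ≠ ∞ ∧
          ξ σ (z, a ω) (restrictTo (markedProcess x α ω)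
            (Metric.closedBall z (R (z, a ω) (markedProcess x α ω)))) =
              ξ σ (z, a ω) (markedProcess x α ω) ∧
          ∀ᶠ ρ : ℝ in atTop,
            ξ σ (z, a ω) (restrictTo (markedProcess x α ω) (Metric.closedBall z ρ)) =
              ξ σ (z, a ω) (markedProcess x α ω)) ∧
      -- almost surely the whole-plane tessellation is well defined, with all its branches finite
      ∀ᵐ ω ∂P,
        (∃! ℓ, IsGrowth (markedProcess x α ω) ℓ) ∧
        (∀ p ∈ markedProcess x α ω, ∀ σ : Side,
          ξ σ p (markedProcess x α ω) ≠ ∞ ∧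
          ∀ᶠ ρ : ℝ in atTop,
            ξ σ p (restrictTo (markedProcess x α ω) (Metric.closedBall p.1 ρ)) =
              ξ σ p (markedProcess x α ω)) ∧
        tessellation (markedProcess x α ω) =
          ⋃ p ∈ markedProcess x α ω, ⋃ σ : Side,
            segment ℝ p.1 (tip p σ (ξ σ p (markedProcess x α ω)).toReal) := by
  have hp := obstacleProb_pos hτ
  refine ⟨obstacleProb τ / 20, by positivity,
    896 / obstacleProb τ * Real.exp (obstacleProb τ * (14 / 20)), by positivity, ?_⟩
  intro Ω _ P _ x α a h ha
  refine ⟨fun σ => ⟨stabilizationRadius, fun z => ?_⟩, ?_⟩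
  -- On this event propagation applies with `s = R / 2`, so that `2 * s` is exactly the radius.
  · have key : ∀ᵐ ω ∂P, IsLocallyFinite (markedProcess x α ω) ∧
        (∀ q ∈ markedProcess x α ω, q.1 ≠ z) ∧
        ξ σ (z, a ω) (markedProcess x α ω) <
          ENNReal.ofReal (stabilizationRadius (z, a ω) (markedProcess x α ω) / 2) := by
      filter_upwards [h.ae_isLocallyFinite, h.ae_fst_ne z, ae_mem_Ico_of_hasLaw ha.law,
        h.ae_exists_isSurrounded hτ z] with ω hlf hne hmark hsur
      exact ⟨hlf, hne, ξ_lt_of_exists_isSurrounded (hlf.insert hne) hmark σ hsur⟩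
    have hhalf : ∀ R : ℝ≥0, 2 * ((R : ℝ) / 2) = R := fun R => by ring
    refine ⟨⟨(h.measurable_stabilizationRadius z a).aemeasurable, ?_⟩, fun r _ =>
      h.measure_lt_stabilizationRadius_le hτ z a r, ?_⟩
    · filter_upwards [key] with ω ⟨hlf, hne, hlt⟩ A hA hconf hout
      have h1 := ξ_restrictTo_union hlf hne σ hlt hA hconf.1 (by rwa [hhalf])
      have h2 := ξ_restrictTo (hlf.insert hne) σ hlt le_rfl
      rw [hhalf] at h1 h2
      exact h2.trans h1.symm
    · filter_upwards [key] with ω ⟨hlf, hne, hlt⟩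
      have hX := hlf.insert (p := (z, a ω)) hne
      refine ⟨existsUnique_isGrowth_of_isLocallyFinite hX, hlt.ne_top, ?_, ?_⟩
      · exact ξ_restrictTo hX σ hlt (hhalf _).le
      · filter_upwards [eventually_ge_atTop _] with ρ hρ
        exact ξ_restrictTo hX σ hlt hρ
  · filter_upwards [h.ae_isLocallyFinite, h.ae_forall_ξ_ne_top hτ] with ω hlf hfin
    refine ⟨existsUnique_isGrowth_of_isLocallyFinite hlf, fun p hp σ => ⟨hfin p hp σ, ?_⟩,
      tessellation_eq hfin⟩
    -- For the seeds of the process no tail bound is needed: any `s` above the finite length gives a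
    -- window size beyond which the value is constant.
    have hlt : ξ σ p (markedProcess x α ω) <
        ENNReal.ofReal ((ξ σ p (markedProcess x α ω)).toReal + 1) := by
      rw [ENNReal.lt_ofReal_iff_toReal_lt (hfin p hp σ)]
      linarith
    filter_upwards [eventually_ge_atTop _] with ρ hρ
    exact ξ_restrictTo (by rwa [Set.insert_eq_of_mem hp]) σ hlt hρ
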